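/- Let $\rho_1,\dots,\rho_m$ be germs at $0\in\mathbb C^n$ of anti-holomorphic involutions fixing the origin, $\rho_i(z)=B_i\bar z+R_i(\bar z)$ with $B_i\in GL_n(\mathbb C)$ and $R_i$ a germ of holomorphic map with $R_i(0)=0$, $DR_i(0)=0$ (equivalently, let $M_1,\dots,M_m$ be germs of real analytic totally real $n$-dimensional submanifolds of $\mathbb C^n$ through $0$, $M_i$ being the fixed point set of $\rho_i$). Assume that the group generated by the germs of biholomorphisms $F_{i,j}=\rho_i\circ\rho_j$, $1\le i,j\le m$, is abelian, and that the linear parts $D_{i,j}=B_i\overline{B_j}$ of the $F_{i,j}$ at $0$ are diagonal, $D_{i,j}=\mathrm{diag}(\mu_{i,j,1},\dots,\mu_{i,j,n})$. Let $D=\{D_{i,j}\}_{1\le i,j\le m}$. For $Q\in\mathbb N^n$ write $|Q|=q_1+\dots+q_n$, $x^Q=x_1^{q_1}\cdots x_n^{q_n}$ and $\mu_{i,j}^Q=\prod_a\mu_{i,j,a}^{q_a}$. Let $x^{R_1},\dots,x^{R_p}$ be finitely many nonconstant monomials generating the ring of formal invariants of $D$, that is $$\{f\in\mathbb C[[x_1,\dots,x_n]]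 : f(D_{i,j}x)=f(x)\ \text{for all } i,j\}=\mathbb C[[x^{R_1},\dots,x^{R_p}]],$$ and let $\mathcal I$ be the ideal generated by $x^{R_1},\dots,x^{R_p}$ in the ring $\mathcal O_n$ of germs at $0$ of holomorphic functions. Assume that the nonlinear centralizer of $D$ is generated by the same monomials: every $n$-tuple $F$ of formal power series without terms of degree $<2$ such that $F(D_{i,j}x)=D_{i,j}F(x)$ for all $i,j$ has all its components in the ideal of $\mathbb C[[x_1,\dots,x_n]]$ generated by $x^{R_1},\dots,x^{R_p}$ (equivalently: if $|Q|\ge2$ and, for some $k$, $\mu_{i,j}^Q=\mu_{i,j,k}$ for all $i,j$, then $x^Q$ belongs to this ideal). Assume that $D$ is diophantine on $\mathcal I$, that is $$-\sum_{k\ge1}\frac{\ln\omega_k}{2^k}<+\infty,\qquad \omega_k=\inf\Bigl\{\max_{i,j}|\mu_{i,j}^Q-\mu_{i,j,a}|\neq0 \;:\; Q\in\mathbb N^n,\ 2\le|Q|\le2^k,\ x^Q\notin\mathcal I,\ 1\le a\le n\Bigr\}$$ (the indices $k$ for which this set is empty are omitted from the sum). Then there is a system of holomorphic coordinates $z=\Phi(x)$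 near the origin, with $\Phi(0)=0$ and $D\Phi(0)=\mathrm{Id}$, such that the following holds. In the coordinates $z$, the germ of analytic set $V(\mathcal I)$ defined by the ideal $\mathcal I=(z^{R_1},\dots,z^{R_p})$ is $$V(\mathcal I)=\{z\in(\mathbb C^n,0) : z^{R_1}=\dots=z^{R_p}=0\},$$ and, for every $i$, the involution $\rho_i$, written in the coordinates $z$ (that is, $\Phi\circ\rho_i\circ\Phi^{-1}$), maps $V(\mathcal I)$ into itself and satisfies $$\rho_{i|V(\mathcal I)}(z)=B_i\bar z .$$ -/

import Mathlib

open Filter Topology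

noncomputable section

namespace TotallyReal

/-- The monomial function `z ↦ z^Q = z₁^{q₁} ⋯ zₙ^{qₙ}` on `ℂⁿ`. -/
def monomialFun {n : ℕ} (Q : Fin n →₀ ℕ) (z : Fin n → ℂ) : ℂ := ∏ a, z a ^ Q a

theorem analyticAt_monomialFun {n : ℕ} (Q : Fin n →₀ ℕ) (x : Fin n → ℂ) :
    AnalyticAt ℂ (monomialFun Q) x := by
  unfold monomialFun
  refine Finset.analyticAt_fun_prod _ fun a _ => ?_
  exact ((ContinuousLinearMap.proj (R := ℂ) (φ := fun _ : Fin n => ℂ) a).analyticAt x).pow _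

/-- The ring `𝒪ₙ` of germs at the origin of holomorphic functions on `ℂⁿ`. -/
def HolGerm (n : ℕ) : Subring (Germ (𝓝 (0 : Fin n → ℂ)) ℂ) where
  carrier := {g | ∃ f : (Fin n → ℂ) → ℂ, AnalyticAt ℂ f 0 ∧ (f : Germ (𝓝 (0 : Fin n → ℂ)) ℂ) = g}
  mul_mem' := by
    rintro _ _ ⟨f, hf, rfl⟩ ⟨g, hg, rfl⟩
    exact ⟨f * g, hf.mul hg, rfl⟩
  one_mem' := ⟨1, analyticAt_const, rfl⟩
  add_mem' := by
    rintro _ _ ⟨f, hf, rfl⟩ ⟨g, hg, rfl⟩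
    exact ⟨f + g, hf.add hg, rfl⟩
  zero_mem' := ⟨0, analyticAt_const, rfl⟩
  neg_mem' := by
    rintro _ ⟨f, hf, rfl⟩
    exact ⟨-f, hf.neg, rfl⟩

/-- The germ at the origin of a function that is holomorphic near the origin. -/
def toHolGerm {n : ℕ} (f : (Fin n → ℂ) → ℂ) (hf : AnalyticAt ℂ f 0) : HolGerm n :=
  ⟨(f : Germ (𝓝 (0 : Fin n → ℂ)) ℂ), f, hf, rfl⟩

/-- The monomial `x^Q` as an element of `𝒪ₙ`. -/
def monomialGerm {n : ℕ} (Q : Fin n →₀ ℕ) : HolGerm n :=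
  toHolGerm (monomialFun Q) (analyticAt_monomialFun Q 0)

/-- The ideal of `𝒪ₙ` generated by the monomials `x^{R_1}, …, x^{R_p}`. -/
def monomialIdeal {n p : ℕ} (R : Fin p → (Fin n →₀ ℕ)) : Ideal (HolGerm n) :=
  Ideal.span (Set.range fun k => monomialGerm (R k))

/-- The germ at `0` of the set `V` is the analytic germ `V(J)` defined by the ideal `J` of `𝒪ₙ`:
every element of `J` vanishes on `V` near the origin, and near the origin `V` contains the common
zeros of finitely many elements of `J`. -/
def IsZeroLocus {n : ℕ} (J : Ideal (HolGerm n)) (V : Set (Fin n → ℂ)) : Prop :=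
  (∀ (f : (Fin n → ℂ) → ℂ) (hf : AnalyticAt ℂ f 0), toHolGerm f hf ∈ J →
    ∀ᶠ z in 𝓝 (0 : Fin n → ℂ), z ∈ V → f z = 0) ∧
  ∃ (r : ℕ) (f : Fin r → (Fin n → ℂ) → ℂ) (hf : ∀ s, AnalyticAt ℂ (f s) 0),
    (∀ s, toHolGerm (f s) (hf s) ∈ J) ∧
    ∀ᶠ z in 𝓝 (0 : Fin n → ℂ), (∀ s, f s z = 0) → z ∈ V

section Diagonal

/-! Below, `μ : ι → Fin n → ℂ` encodes the finite family of diagonal linear maps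
`D_i = diag(μ_{i,1}, …, μ_{i,n})`, `i : ι`. -/

/-- `max_i |μ_i^Q - μ_{i,j}|`. -/
def smallDivisor {n : ℕ} {ι : Type*} [Finite ι] (μ : ι → Fin n → ℂ) (Q : Fin n →₀ ℕ)
    (j : Fin n) : ℝ :=
  ⨆ i, ‖monomialFun Q (μ i) - μ i j‖

/-- The nonzero small divisors `max_i |μ_i^Q - μ_{i,j}|` with `2 ≤ |Q| ≤ 2^k` and `x^Q ∉ J`. -/
def smallDivisorSet {n : ℕ} {ι : Type*} [Finite ι] (μ : ι → Fin n → ℂ) (J : Ideal (HolGerm n))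
    (k : ℕ) : Set ℝ :=
  {d | d ≠ 0 ∧ ∃ (Q : Fin n →₀ ℕ) (j : Fin n), 2 ≤ Q.degree ∧ Q.degree ≤ 2 ^ k ∧
    monomialGerm Q ∉ J ∧ d = smallDivisor μ Q j}

open Classical in
/-- `-ln ω_k(D, J)`, where `ω_k(D, J)` is the infimum of the set of small divisors of level `k`.
If this set is empty there is no condition at level `k`, and the value is `0`. -/
def negLogOmega {n : ℕ} {ι : Type*} [Finite ι] (μ : ι → Fin n → ℂ) (J : Ideal (HolGerm n))
    (k : ℕ) : ℝ :=
  if (smallDivisorSet μ J k).Nonempty then -Real.log (sInf (smallDivisorSet μ J k)) else 0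

/-- The family `D` is diophantine on the ideal `J`: `-∑_{k ≥ 1} ln ω_k(D, J) / 2^k < +∞`.
Since `ω_k` is nonincreasing in `k`, the terms are bounded below by a summable sequence, so
finiteness of the sum is summability. -/
def IsDiophantineOn {n : ℕ} {ι : Type*} [Finite ι] (μ : ι → Fin n → ℂ)
    (J : Ideal (HolGerm n)) : Prop :=
  Summable fun k : ℕ => negLogOmega μ J (k + 1) / 2 ^ (k + 1)

/-- The ring of formal invariants of `D`: the formal power series `f` with `f(D_i x) = f(x)` for
all `i`. -/
def formalInvariants {n : ℕ} {ι : Type*} (μ : ι → Fin n → ℂ) :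
    Subring (MvPowerSeries (Fin n) ℂ) where
  carrier := {f | ∀ i, MvPowerSeries.rescale (μ i) f = f}
  mul_mem' := by
    intro f g hf hg i
    rw [map_mul, hf i, hg i]
  one_mem' := fun i => map_one _
  add_mem' := by
    intro f g hf hg i
    rw [map_add, hf i, hg i]
  zero_mem' := fun i => map_zero _
  neg_mem' := by
    intro f hf i
    rw [map_neg, hf i]

/-- The ring of formal invariants of `D` is generated, as a ring of formal power series, by the
monomials `x^{R_1}, …, x^{R_p}`: it is `ℂ⟦x^{R_1}, …, x^{R_p}⟧`, the set of all `g(x^{R_1}, …,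
x^{R_p})` with `g` a formal power series in `p` variables. (To be used for nonconstant monomials,
for which the substitution makes sense.) -/
def InvariantsGeneratedBy {n p : ℕ} {ι : Type*} (μ : ι → Fin n → ℂ)
    (R : Fin p → (Fin n →₀ ℕ)) : Prop :=
  (formalInvariants μ : Set (MvPowerSeries (Fin n) ℂ)) =
    Set.range fun g : MvPowerSeries (Fin p) ℂ =>
      MvPowerSeries.subst (fun k => (MvPowerSeries.monomial (R k) (1 : ℂ))) g

/-- The nonlinear formal centralizer of `D`: the `n`-tuples `F` of formal power series without
terms of degree less than `2` such that `F(D_i x) = D_i F(x)` for all `i`. -/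
def formalCentralizer {n : ℕ} {ι : Type*} (μ : ι → Fin n → ℂ) :
    Set (Fin n → MvPowerSeries (Fin n) ℂ) :=
  {F | (∀ j, ∀ Q : Fin n →₀ ℕ, Q.degree < 2 → MvPowerSeries.coeff Q (F j) = 0) ∧
    ∀ i j, MvPowerSeries.rescale (μ i) (F j) = μ i j • F j}

/-- The nonlinear centralizer of `D` is generated by the monomials `x^{R_1}, …, x^{R_p}`: all
components of its elements lie in the ideal of formal power series generated by these monomials,
that is, `x^Q` belongs to this ideal whenever `|Q| ≥ 2` and, for some `j`, `μ_i^Q = μ_{i,j}` for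
all `i`. -/
def CentralizerGeneratedBy {n p : ℕ} {ι : Type*} (μ : ι → Fin n → ℂ)
    (R : Fin p → (Fin n →₀ ℕ)) : Prop :=
  ∀ F ∈ formalCentralizer μ, ∀ j,
    F j ∈ Ideal.span (Set.range fun k => (MvPowerSeries.monomial (R k) (1 : ℂ)))

end Diagonal

/-- `ρ` is (a representative of) a germ at the origin of `ℂⁿ` of anti-holomorphic involution
fixing the origin, `ρ(z) = B z̄ + O(|z|²)`: the map `w ↦ ρ(w̄)` is holomorphic near `0` with
differential `B` at `0`, and `ρ ∘ ρ = id` near `0`. Its fixed point set is the germ of a totally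
real real analytic `n`-submanifold, and every such germ is obtained from a unique `ρ`. -/
structure IsAntiholInvolution {n : ℕ} (ρ : (Fin n → ℂ) → (Fin n → ℂ))
    (B : Matrix (Fin n) (Fin n) ℂ) : Prop where
  map_zero : ρ 0 = 0
  antiholomorphic : AnalyticAt ℂ (fun w => ρ (star w)) 0
  linearPart : HasFDerivAt (fun w => ρ (star w)) B.mulVecLin.toContinuousLinearMap 0
  involutive : ∀ᶠ z in 𝓝 (0 : Fin n → ℂ), ρ (ρ z) = z

/-- The matrix `D_{i,j} = B_i B̄_j`, the linear part at the origin of `F_{i,j} = ρ_i ∘ ρ_j`. -/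
def linMatrix {n m : ℕ} (B : Fin m → Matrix (Fin n) (Fin n) ℂ) (q : Fin m × Fin m) :
    Matrix (Fin n) (Fin n) ℂ :=
  B q.1 * (B q.2).map (starRingEnd ℂ)

/-- The group generated by the germs `F_{i,j} = ρ_i ∘ ρ_j` is abelian, i.e. its generators
commute as germs at the origin. -/
def IsCommutative {n m : ℕ} (ρ : Fin m → (Fin n → ℂ) → (Fin n → ℂ)) : Prop :=
  ∀ i j k l, ∀ᶠ z in 𝓝 (0 : Fin n → ℂ), ρ i (ρ j (ρ k (ρ l z))) = ρ k (ρ l (ρ i (ρ j z)))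

/-- A holomorphic coordinate system `z = Φ(x)` near the origin, centered at the origin and
tangent to the identity there. -/
structure IsHolCoord {n : ℕ} (Φ : OpenPartialHomeomorph (Fin n → ℂ) (Fin n → ℂ)) : Prop where
  zero_mem : (0 : Fin n → ℂ) ∈ Φ.source
  map_zero : Φ 0 = 0
  holomorphic : AnalyticOnNhd ℂ Φ Φ.source
  holomorphic_symm : AnalyticOnNhd ℂ Φ.symm Φ.target
  tangent_id : HasFDerivAt Φ (ContinuousLinearMap.id ℂ (Fin n → ℂ)) 0

end TotallyReal

end

/-!
The coordinates `Φ` are the inverse of a holomorphic map `Ψ`, tangent to the identity, that conjugates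
every `F_q = ρ_i ∘ ρ_j` to its linear part `D_q` modulo the monomial ideal. All nonlinear
monomials of `Ψ` lie outside the ideal, so that no resonance is met.

*Functions modulo the ideal.* Let `S` be the set of exponents of the monomials in the ideal. Instead of
formal power series, the proof uses the relation `MemUpTo S d f`: the function `f` is, up to `O(‖z‖^d)`,
a polynomial all of whose monomials have their exponents in `S`. By `memUpTo_iff` this only depends on
the Taylor coefficients. If `F` is holomorphic, then perturbing the argument of `F` by a term `v`
that vanishes modulo `S` up to degree `d` changes `F` by `DF(0) v`, modulo `S` and up to degree `d + 1`
(`HasTail.memUpTo_sub`).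

*Formal solution.* The equation `F_q ∘ Ψ = Ψ ∘ D_q` is solved degree by degree, simultaneously for all
`q`. The coefficient of `x^Q`, `Q ∉ S`, in the `j`-th component has to be the quotient of that of the
defect by `μ_q^Q - μ_{q,j}`; this does not depend on `q` because the `F_q` commute (`defect_comm`), and
some divisor is nonzero because the centralizer is generated by the monomials of the ideal
(`exists_formal_conjugacy`). The solution modulo the ideal is unique (`memUpTo_sub_of_defect`).

*Convergence.* Brjuno's counting of small divisors is packed into a weight `W` on exponents that is
supermultiplicative and satisfies `W P * W Q ≤ δ (P + Q) * W (P + Q)`, where `δ` is the small divisor,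
as soon as `P`, `Q` are nonzero and `P + Q ∉ S` (`exists_weight`). It is a product over dyadic
levels, and at each level the number of divisors that can be that small is an explicit superadditive
function (`exists_superadditive_count`). In the norm `∑ |g_Q| r^|Q| / W Q`, which is
submultiplicative, a product of two series without constant term may therefore be divided by the
small divisors for free. For `r` small the recursion for `Ψ` then stays in a ball (`exists_coeff_bound`),
and since `W` grows at most geometrically, `Ψ` converges (`exists_analytic_conjugacy`).

*The involutions.* From commutativity, `F_{j,k} ∘ ρ_i = ρ_i ∘ F_{k,j}`. Since the map `z ↦ B_i z̄` conjugates
`D_{j,k}` to `D_{k,j}`, it preserves the ideal: the conjugate of a generator composed with it is an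
invariant without constant term (`conjSubst_monomial_mem`). Consequently `ρ_i ∘ Ψ ∘ (B_i z̄)` is
another conjugacy tangent to the identity, and by uniqueness it agrees with `Ψ` modulo the ideal.
Restricting the difference to complex lines through the origin shows that the two maps coincide on the
zero locus (`eventually_eq_zero_on_locus`), which is the assertion.
-/

noncomputable section

namespace TotallyReal

/-! ### Counting small divisors and weights -/

/-- The counting lemma of Brjuno in superadditive form. Let `K` be a set of exponents of degree greater
than `m` such that the degrees of comparable elements differ by at least `m`. Then there is a
superadditive function `N`, at most `2 |Q| / m`, that gains `1` at each sum lying in `K`; so it bounds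
the number of elements of `K` met in any iterated decomposition of `Q`.

The function is explicit: for `|Q| > m` it is `t / m - 2`, where `t` is the least of `2 |Q| + m` and
the numbers `2 |Q'|` with `Q < Q' ∈ K`. -/
theorem exists_superadditive_count {σ : Type*} (K : Set (σ →₀ ℕ)) (m : ℕ)
    (hm : 0 < m) (hK : ∀ Q ∈ K, m < Q.degree)
    (hgap : ∀ Q ∈ K, ∀ Q' ∈ K, Q < Q' → Q.degree + m ≤ Q'.degree) :
    ∃ N : (σ →₀ ℕ) → ℝ, (∀ Q, 0 ≤ N Q) ∧ (∀ Q, Q.degree ≤ m → N Q = 0) ∧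
      (∀ Q, N Q ≤ 2 * Q.degree / m) ∧ (∀ P Q, N P + N Q ≤ N (P + Q)) ∧
      ∀ P Q, P ≠ 0 → Q ≠ 0 → P + Q ∈ K → 1 + (N P + N Q) ≤ N (P + Q) := by
  obtain ⟨t, ht1, ht2, ht3⟩ : ∃ t : (σ →₀ ℕ) → ℕ, (∀ Q, t Q ≤ 2 * Q.degree + m) ∧
      (∀ Q, ∀ Q' ∈ K, Q < Q' → t Q ≤ 2 * Q'.degree) ∧
      (∀ Q x, x ≤ 2 * Q.degree + m → (∀ Q' ∈ K, Q < Q' → x ≤ 2 * Q'.degree) → x ≤ t Q) := by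
    refine ⟨fun Q => sInf (insert (2 * Q.degree + m) {y | ∃ Q' ∈ K, Q < Q' ∧ y = 2 * Q'.degree}),
      fun Q => Nat.sInf_le (Set.mem_insert _ _),
      fun Q Q' h1 h2 => Nat.sInf_le (Set.mem_insert_of_mem _ ⟨Q', h1, h2, rfl⟩),
      fun Q x h1 h2 => le_csInf (Set.insert_nonempty _ _) ?_⟩
    rintro b (rfl | ⟨Q', h3, h4, rfl⟩)
    · exact h1
    · exact h2 Q' h3 h4
  have hdeg (P Q : σ →₀ ℕ) : (P + Q).degree = P.degree + Q.degree := map_add _ _ _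
  have hlt (P Q : σ →₀ ℕ) (hP : P ≠ 0) (hQ : Q ≠ 0) : P < P + Q ∧ Q < P + Q ∧
      0 < P.degree ∧ 0 < Q.degree := by
    refine ⟨lt_add_of_pos_right _ (pos_iff_ne_zero.2 hQ),
      lt_add_of_pos_left _ (pos_iff_ne_zero.2 hP), ?_, ?_⟩ <;>
    · rw [Nat.pos_iff_ne_zero]
      simpa [Finsupp.degree_eq_zero_iff]
  classical
  let N : (σ →₀ ℕ) → ℕ := fun Q => if Q.degree ≤ m then 0 else t Q - 2 * m
  have key (P Q : σ →₀ ℕ) (hP : P ≠ 0) (hQ : Q ≠ 0) :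
      N P + N Q ≤ N (P + Q) ∧ (P + Q ∈ K → N P + N Q + m ≤ N (P + Q)) := by
    obtain ⟨hl1, hl2, hp, hq⟩ := hlt P Q hP hQ
    have h1 := ht1 P
    have h2 := ht1 Q
    have hd := hdeg P Q
    have hKPQ := hK (P + Q)
    have mono1 : t P ≤ t (P + Q) := ht3 _ _ (by omega) fun Q' h h' => ht2 _ _ h (hl1.trans h')
    have mono2 : t Q ≤ t (P + Q) := ht3 _ _ (by omega) fun Q' h h' => ht2 _ _ h (hl2.trans h')
    -- `t` attains its largest possible value at an element of `K`, by the gap hypothesis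
    have bad (hb : P + Q ∈ K) : t (P + Q) = 2 * (P + Q).degree + m := by
      refine le_antisymm (ht1 _) (ht3 _ _ le_rfl fun Q' h h' => ?_)
      have := hgap _ hb _ h h'
      omega
    have big : 2 * (P + Q).degree ≤ t (P + Q) := by
      refine ht3 _ _ (by omega) fun Q' h h' => ?_
      have := Finsupp.degree_mono h'.le
      omega
    have hb1 (hb : P + Q ∈ K) := ht2 P _ hb hl1
    have hb2 (hb : P + Q ∈ K) := ht2 Q _ hb hl2
    simp only [N]
    by_cases hb : P + Q ∈ K
    · have := bad hb
      have := hb1 hb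
      have := hb2 hb
      have := hKPQ hb
      split_ifs <;> omega
    · split_ifs <;> refine ⟨?_, fun h => absurd h hb⟩ <;> omega
  have hm' : (0 : ℝ) < m := by exact_mod_cast hm
  have h0 : N 0 = 0 := by simp [N]
  refine ⟨fun Q => (N Q : ℝ) / m, fun Q => by positivity, fun Q hQ => by simp [N, hQ],
    fun Q => ?_, fun P Q => ?_, fun P Q hP hQ h => ?_⟩
  · refine div_le_div_of_nonneg_right ?_ hm'.le
    have := ht1 Q
    have : N Q ≤ 2 * Q.degree := by
      simp only [N]
      split_ifs <;> omega
    exact_mod_cast this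
  · rw [← add_div]
    refine div_le_div_of_nonneg_right ?_ hm'.le
    rcases eq_or_ne P 0 with rfl | hP
    · simp [h0]
    rcases eq_or_ne Q 0 with rfl | hQ
    · simp [h0]
    exact_mod_cast (key P Q hP hQ).1
  · rw [← add_div, ← div_self hm'.ne', ← add_div]
    refine div_le_div_of_nonneg_right ?_ hm'.le
    rw [add_comm]
    exact_mod_cast (key P Q hP hQ).2 h

/-- Let `δ j Q` be divisors attached to exponents `Q ∈ A`, bounded below by `ε k` for
`|Q| ≤ 2^(k+1)`, where `ε` satisfies Brjuno's summability condition, and such that two comparable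
exponents with divisors less than `ε k` have degrees at least `2^(k+1)` apart. Then there is a
supermultiplicative weight, at most geometrically growing, for which splitting an element of `A` into
two nonzero summands gains at least the factor `δ j`.

Its logarithm is the sum over `k` and `j` of the counting functions for the exponents with
`δ j Q < ε k`, with coefficient `-log (ε (k + 1))`, plus `-log (ε 0)` times `|Q| - 1`. -/
theorem exists_weight {σ J : Type*} [Fintype J] (δ : J → (σ →₀ ℕ) → ℝ) (A : Set (σ →₀ ℕ))
    (ε : ℕ → ℝ) (hε : ∀ k, 0 < ε k) (hε1 : ∀ k, ε k ≤ 1)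
    (hsum : Summable fun k => -Real.log (ε k) / 2 ^ (k + 1))
    (hsmall : ∀ k j, ∀ Q ∈ A, Q.degree ≤ 2 ^ (k + 1) → ε k ≤ δ j Q)
    (hgap : ∀ k j, ∀ Q ∈ A, ∀ Q' ∈ A, δ j Q < ε k → δ j Q' < ε k → Q < Q' →
      Q.degree + 2 ^ (k + 1) ≤ Q'.degree) :
    ∃ W : (σ →₀ ℕ) → ℝ, (∀ Q, 1 ≤ W Q) ∧ (∀ Q, Q.degree ≤ 1 → W Q = 1) ∧
      (∃ C, 1 ≤ C ∧ ∀ Q, W Q ≤ C ^ Q.degree) ∧ (∀ P Q, W P * W Q ≤ W (P + Q)) ∧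
      ∀ P Q, P ≠ 0 → Q ≠ 0 → P + Q ∈ A → ∀ j, W P * W Q ≤ δ j (P + Q) * W (P + Q) := by
  have hcount (k : ℕ) (j : J) := exists_superadditive_count {Q | Q ∈ A ∧ δ j Q < ε k}
    (2 ^ (k + 1)) (by positivity)
    (fun Q hQ => by by_contra! h; exact absurd (hsmall k j Q hQ.1 h) (not_le.2 hQ.2))
    (fun Q hQ Q' hQ' h => hgap k j Q hQ.1 Q' hQ'.1 hQ.2 hQ'.2 h)
  choose N hN0 hN1 hN2 hN3 hN4 using hcount
  let w : ℕ → ℝ := fun k => -Real.log (ε k)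
  have hw (k) : 0 ≤ w k := by
    have := Real.log_nonpos (hε k).le (hε1 k)
    simp only [w]; linarith
  let f : (σ →₀ ℕ) → ℕ → ℝ := fun Q k => w (k + 1) * ∑ j, N k j Q
  let g : ℕ → ℝ := fun k => w (k + 1) / 2 ^ (k + 1 + 1)
  have hg : Summable g := (summable_nat_add_iff 1).2 hsum
  have hg0 (k) : 0 ≤ g k := div_nonneg (hw _) (by positivity)
  have hf0 (Q k) : 0 ≤ f Q k := mul_nonneg (hw _) (Finset.sum_nonneg fun j _ => hN0 _ _ _)
  have hfg (Q k) : f Q k ≤ 4 * Fintype.card J * Q.degree * g k := by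
    have : ∑ j, N k j Q ≤ ∑ j : J, 2 * (Q.degree : ℝ) / (2 : ℝ) ^ (k + 1) :=
      Finset.sum_le_sum fun j _ => by simpa using hN2 k j Q
    simp only [Finset.sum_const, Finset.card_univ, nsmul_eq_mul] at this
    calc f Q k ≤ w (k + 1) * (Fintype.card J * (2 * (Q.degree : ℝ) / (2 : ℝ) ^ (k + 1))) :=
          mul_le_mul_of_nonneg_left this (hw _)
      _ = _ := by simp only [g]; field_simp; ring
  have hfs (Q) : Summable (f Q) :=
    Summable.of_nonneg_of_le (hf0 Q) (hfg Q) (hg.mul_left _)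
  let L : (σ →₀ ℕ) → ℝ := fun Q => w 0 * ((Q.degree - 1 : ℕ) : ℝ) + ∑' k, f Q k
  have hdeg (P Q : σ →₀ ℕ) : (P + Q).degree = P.degree + Q.degree := map_add _ _ _
  have hfadd (P Q k) : f P k + f Q k ≤ f (P + Q) k := by
    simp only [f]
    rw [← mul_add, ← Finset.sum_add_distrib]
    exact mul_le_mul_of_nonneg_left (Finset.sum_le_sum fun j _ => hN3 _ _ _ _) (hw _)
  refine ⟨fun Q => Real.exp (L Q), fun Q => ?_, fun Q hQ => ?_,
    ⟨Real.exp (w 0 + 4 * Fintype.card J * ∑' k, g k), ?_, fun Q => ?_⟩, fun P Q => ?_,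
    fun P Q hP hQ hPQ j => ?_⟩
  · rw [Real.one_le_exp_iff]
    exact add_nonneg (mul_nonneg (hw _) (Nat.cast_nonneg _)) (tsum_nonneg (hf0 Q))
  · have hf (k) : f Q k = 0 := by
      have : Q.degree ≤ 2 ^ (k + 1) := hQ.trans Nat.one_le_two_pow
      simp [f, hN1 k _ Q this]
    simp [L, hf, Nat.sub_eq_zero_of_le hQ]
  · rw [Real.one_le_exp_iff]
    exact add_nonneg (hw _) (mul_nonneg (by positivity) (tsum_nonneg hg0))
  · rw [← Real.exp_nat_mul]
    refine Real.exp_le_exp.2 ?_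
    have h1 : ∑' k, f Q k ≤ 4 * Fintype.card J * Q.degree * ∑' k, g k := by
      rw [← tsum_mul_left]
      exact (hfs Q).tsum_le_tsum (hfg Q) (hg.mul_left _)
    have h2 : w 0 * ((Q.degree - 1 : ℕ) : ℝ) ≤ w 0 * Q.degree :=
      mul_le_mul_of_nonneg_left (by exact_mod_cast Nat.sub_le _ _) (hw _)
    calc L Q ≤ w 0 * Q.degree + 4 * Fintype.card J * Q.degree * ∑' k, g k := add_le_add h2 h1
      _ = _ := by ring
  · rw [← Real.exp_add]
    refine Real.exp_le_exp.2 ?_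
    have h1 : ∑' k, f P k + ∑' k, f Q k ≤ ∑' k, f (P + Q) k := by
      rw [← (hfs P).tsum_add (hfs Q)]
      exact ((hfs P).add (hfs Q)).tsum_le_tsum (hfadd P Q) (hfs _)
    have h2 : w 0 * ((P.degree - 1 : ℕ) : ℝ) + w 0 * ((Q.degree - 1 : ℕ) : ℝ) ≤
        w 0 * (((P + Q).degree - 1 : ℕ) : ℝ) := by
      rw [← mul_add]
      refine mul_le_mul_of_nonneg_left ?_ (hw _)
      have := hdeg P Q
      exact_mod_cast (by omega : P.degree - 1 + (Q.degree - 1) ≤ (P + Q).degree - 1)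
    simp only [L]
    linarith
  · have hδ : 0 < δ j (P + Q) :=
      (hε _).trans_le (hsmall (P + Q).degree j _ hPQ
        ((Nat.lt_two_pow_self.le).trans (Nat.pow_le_pow_right two_pos (Nat.le_succ _))))
    have hdP : 1 ≤ P.degree := by
      rw [Nat.one_le_iff_ne_zero]; simpa [Finsupp.degree_eq_zero_iff]
    have hdQ : 1 ≤ Q.degree := by
      rw [Nat.one_le_iff_ne_zero]; simpa [Finsupp.degree_eq_zero_iff]
    have hex : ∃ k, ε k ≤ δ j (P + Q) := ⟨(P + Q).degree, hsmall _ j _ hPQ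
        ((Nat.lt_two_pow_self.le).trans (Nat.pow_le_pow_right two_pos (Nat.le_succ _)))⟩
    classical
    -- the divisor is at least `ε k` for the first `k` at which `P + Q` is not counted
    have hlog : -Real.log (δ j (P + Q)) + (L P + L Q) ≤ L (P + Q) := by
      have hd := hdeg P Q
      have e0 : ((P + Q).degree - 1 : ℕ) = (P.degree - 1) + (Q.degree - 1) + 1 := by omega
      have h2 : w 0 * (((P + Q).degree - 1 : ℕ) : ℝ) =
          w 0 * ((P.degree - 1 : ℕ) : ℝ) + w 0 * ((Q.degree - 1 : ℕ) : ℝ) + w 0 := by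
        rw [e0]; push_cast; ring
      have h1 : ∑' k, f P k + ∑' k, f Q k ≤ ∑' k, f (P + Q) k := by
        rw [← (hfs P).tsum_add (hfs Q)]
        exact ((hfs P).add (hfs Q)).tsum_le_tsum (hfadd P Q) (hfs _)
      have hle : -Real.log (δ j (P + Q)) ≤ w (Nat.find hex) :=
        neg_le_neg (Real.log_le_log (hε _) (Nat.find_spec hex))
      rcases hk : Nat.find hex with _ | k
      · rw [hk] at hle
        simp only [L]
        linarith
      · rw [hk] at hle
        have hbad : δ j (P + Q) < ε k := by
          have := Nat.find_min hex (m := k) (by omega)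
          simpa using this
        have h3 : w (k + 1) + (f P k + f Q k) ≤ f (P + Q) k := by
          have : (∑ i, N k i P + ∑ i, N k i Q) + 1 ≤ ∑ i, N k i (P + Q) := by
            rw [← Finset.sum_add_distrib, ← Finset.add_sum_erase _ _ (Finset.mem_univ j),
              ← Finset.add_sum_erase _ (fun i => N k i (P + Q)) (Finset.mem_univ j)]
            have a1 := hN4 k j P Q hP hQ ⟨hPQ, hbad⟩
            have a2 : ∑ i ∈ Finset.univ.erase j, (N k i P + N k i Q) ≤
              ∑ i ∈ Finset.univ.erase j, N k i (P + Q) := Finset.sum_le_sum fun i _ => hN3 _ _ _ _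
            linarith
          have := mul_le_mul_of_nonneg_left this (hw (k + 1))
          simp only [f]
          linarith
        have h4 : w (k + 1) ≤ ∑' i, (f (P + Q) i - (f P i + f Q i)) := by
          have hs := (hfs (P + Q)).sub ((hfs P).add (hfs Q))
          have := hs.le_tsum k fun i _ => sub_nonneg.2 (hfadd P Q i)
          linarith
        rw [(hfs (P + Q)).tsum_sub ((hfs P).add (hfs Q)), (hfs P).tsum_add (hfs Q)] at h4
        have := hw 0
        simp only [L]
        linarith
    calc Real.exp (L P) * Real.exp (L Q)
        = δ j (P + Q) * Real.exp (-Real.log (δ j (P + Q)) + (L P + L Q)) := by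
          rw [Real.exp_add (-_), Real.exp_neg, Real.exp_log hδ, ← Real.exp_add,
            mul_inv_cancel_left₀ hδ.ne']
      _ ≤ _ := mul_le_mul_of_nonneg_left (Real.exp_le_exp.2 hlog) hδ.le

/-! ### Jets modulo a monomial ideal -/

open Asymptotics MvPolynomial

variable {n : ℕ}

/-- `f` has a Taylor polynomial of every order at the origin. -/
def HasTaylor (f : (Fin n → ℂ) → ℂ) : Prop :=
  ∀ d : ℕ, ∃ T : MvPolynomial (Fin n) ℂ, (fun z => f z - eval z T) =O[𝓝 0] fun z => ‖z‖ ^ d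

/-- The ideal of polynomials all of whose monomials have exponents in the upper set `S`. -/
def monoIdeal (S : UpperSet (Fin n →₀ ℕ)) : Ideal (MvPolynomial (Fin n) ℂ) :=
  restrictSupportIdeal ℂ (S : Set (Fin n →₀ ℕ)) S.upper

theorem mem_monoIdeal {S : UpperSet (Fin n →₀ ℕ)} {g : MvPolynomial (Fin n) ℂ} :
    g ∈ monoIdeal S ↔ ∀ Q ∉ S, coeff Q g = 0 := by
  change (↑g.support : Set (Fin n →₀ ℕ)) ⊆ (S : Set (Fin n →₀ ℕ)) ↔ _
  refine forall_congr' fun Q => ?_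
  rw [Finset.mem_coe, mem_support_iff, not_imp_comm]
  rfl

/-- `f` belongs to the ideal spanned by the monomials with exponents in `S`, up to terms of order `d`
at the origin. -/
def MemUpTo (S : UpperSet (Fin n →₀ ℕ)) (d : ℕ) (f : (Fin n → ℂ) → ℂ) : Prop :=
  ∃ g ∈ monoIdeal S, (fun z => f z - eval z g) =O[𝓝 0] fun z => ‖z‖ ^ d

theorem isBigO_pow_mono {f : (Fin n → ℂ) → ℂ} {d e : ℕ} (h : f =O[𝓝 0] fun z => ‖z‖ ^ e)
    (hde : d ≤ e) : f =O[𝓝 0] fun z => ‖z‖ ^ d := by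
  refine h.trans (IsBigO.of_bound 1 ?_)
  filter_upwards [Metric.ball_mem_nhds (0 : Fin n → ℂ) one_pos] with z hz
  rw [mem_ball_zero_iff] at hz
  simpa using pow_le_pow_of_le_one (norm_nonneg z) hz.le hde

theorem isBigO_one_eval (T : MvPolynomial (Fin n) ℂ) :
    (fun z => eval z T) =O[𝓝 0] fun z : Fin n → ℂ => ‖z‖ ^ 0 := by
  simpa using ((MvPolynomial.continuous_eval T).tendsto (0 : Fin n → ℂ)).isBigO_one ℝ

theorem isBigO_coord (a : Fin n) :
    (fun z : Fin n → ℂ => z a) =O[𝓝 0] fun z : Fin n → ℂ => ‖z‖ ^ 1 := by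
  refine IsBigO.of_bound 1 (Eventually.of_forall fun z => ?_)
  simpa using norm_le_pi_norm z a

theorem isBigO_prod_pow {ι : Type*} (s : Finset ι) (u : ι → (Fin n → ℂ) → ℂ) (e : ι → ℕ)
    (hu : ∀ i ∈ s, u i =O[𝓝 0] fun z => ‖z‖ ^ e i) :
    (fun z => ∏ i ∈ s, u i z) =O[𝓝 0] fun z => ‖z‖ ^ (∑ i ∈ s, e i) := by
  simp_rw [← Finset.prod_pow_eq_pow_sum]
  exact IsBigO.finsetProd hu

theorem isBigO_eval_of_coeff {d : ℕ} {p : MvPolynomial (Fin n) ℂ}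
    (hp : ∀ Q : Fin n →₀ ℕ, Q.degree < d → coeff Q p = 0) :
    (fun z => eval z p) =O[𝓝 0] fun z : Fin n → ℂ => ‖z‖ ^ d := by
  simp_rw [MvPolynomial.eval_eq]
  refine IsBigO.fun_sum (α := Fin n → ℂ) fun Q hQ => ?_
  have hd : d ≤ Q.degree := by
    by_contra! h
    exact (mem_support_iff.1 hQ) (hp Q h)
  refine IsBigO.const_mul_left (isBigO_pow_mono ?_ hd) _
  rw [Finsupp.degree_apply]
  exact isBigO_prod_pow _ _ _ fun a _ => by
    simpa [pow_mul] using ((isBigO_coord a).pow (Q a))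

theorem coeff_eq_zero_of_isBigO_eval {d : ℕ} {p : MvPolynomial (Fin n) ℂ}
    (hp : (fun z => eval z p) =O[𝓝 0] fun z : Fin n → ℂ => ‖z‖ ^ d) :
    ∀ Q : Fin n →₀ ℕ, Q.degree < d → coeff Q p = 0 := by
  suffices h : ∀ k < d, homogeneousComponent k p = 0 by
    intro Q hQ
    have := congrArg (coeff Q) (h _ hQ)
    simpa [coeff_homogeneousComponent] using this
  intro k
  induction k using Nat.strong_induction_on with | _ k ih => ?_
  intro hk
  set q := homogeneousComponent k p with hq
  have hqhom : q.IsHomogeneous k := homogeneousComponent_isHomogeneous k p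
  have h1 : (fun z => eval z q) =O[𝓝 0] fun z : Fin n → ℂ => ‖z‖ ^ (k + 1) := by
    have h2 : (fun z => eval z (p - q)) =O[𝓝 0] fun z : Fin n → ℂ => ‖z‖ ^ (k + 1) := by
      refine isBigO_eval_of_coeff fun Q hQ => ?_
      rcases (Nat.lt_succ_iff.1 hQ).lt_or_eq with h | h
      · have h3 := congrArg (coeff Q) (ih _ h (h.trans hk))
        rw [coeff_homogeneousComponent] at h3
        simp only [if_true, coeff_zero] at h3
        rw [coeff_sub, h3, hq, coeff_homogeneousComponent, if_neg h.ne, sub_zero]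
      · rw [coeff_sub, hq, coeff_homogeneousComponent, if_pos h, sub_self]
    have := (isBigO_pow_mono hp hk).sub h2
    simpa using this
  refine MvPolynomial.funext fun z => ?_
  rw [map_zero]
  -- on the line through `z`, homogeneity turns `O(‖z‖^(k+1))` into the vanishing of `q`
  have ht : Tendsto (fun t : ℝ => (t : ℂ) • z) (𝓝[>] 0) (𝓝 0) := by
    have : Continuous fun t : ℝ => (t : ℂ) • z := by fun_prop
    simpa using (this.tendsto 0).mono_left (nhdsWithin_le_nhds (s := Set.Ioi 0))
  obtain ⟨C, hC⟩ := (h1.comp_tendsto ht).bound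
  have h4 : ∀ᶠ t : ℝ in 𝓝[>] 0, ‖eval z q‖ ≤ C * ‖z‖ ^ (k + 1) * t := by
    filter_upwards [hC, self_mem_nhdsWithin] with t h5 ht
    have ht : 0 < t := ht
    simp only [Function.comp_apply] at h5
    have h6 : eval ((t : ℂ) • z) q = (t : ℂ) ^ k * eval z q := by
      rw [MvPolynomial.eval_eq, MvPolynomial.eval_eq, Finset.mul_sum]
      refine Finset.sum_congr rfl fun Q hQ => ?_
      have h7 : ∑ i ∈ Q.support, Q i = k := (hqhom.degree_eq_sum_deg_support hQ).symm
      simp only [Pi.smul_apply, smul_eq_mul, mul_pow, Finset.prod_mul_distrib,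
        Finset.prod_pow_eq_pow_sum, h7]
      ring
    rw [h6] at h5
    simp only [norm_mul, norm_pow, Complex.norm_real, Real.norm_eq_abs, abs_of_pos ht, norm_smul,
      abs_norm, mul_pow] at h5
    have h7 : t ^ k * ‖eval z q‖ ≤ t ^ k * (C * ‖z‖ ^ (k + 1) * t) := by
      rw [pow_succ t] at h5
      linarith
    exact le_of_mul_le_mul_left h7 (pow_pos ht k)
  have h5 : Tendsto (fun t : ℝ => C * ‖z‖ ^ (k + 1) * t) (𝓝[>] 0) (𝓝 0) := by
    have : Continuous fun t : ℝ => C * ‖z‖ ^ (k + 1) * t := by fun_prop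
    simpa using (this.tendsto 0).mono_left (nhdsWithin_le_nhds (s := Set.Ioi 0))
  exact norm_le_zero_iff.1 (ge_of_tendsto h5 h4)

/-- Membership in a monomial ideal up to order `d` is read off from any Taylor polynomial. -/
theorem memUpTo_iff {S : UpperSet (Fin n →₀ ℕ)} {d : ℕ} {f : (Fin n → ℂ) → ℂ}
    {T : MvPolynomial (Fin n) ℂ} (hT : (fun z => f z - eval z T) =O[𝓝 0] fun z => ‖z‖ ^ d) :
    MemUpTo S d f ↔ ∀ Q ∉ S, Q.degree < d → coeff Q T = 0 := by
  constructor
  · rintro ⟨g, hg, hfg⟩ Q hQ hd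
    have h1 : (fun z => eval z (T - g)) =O[𝓝 0] fun z : Fin n → ℂ => ‖z‖ ^ d := by
      simpa using hfg.sub hT
    have := coeff_eq_zero_of_isBigO_eval h1 Q hd
    rwa [coeff_sub, mem_monoIdeal.1 hg Q hQ, sub_zero] at this
  · intro h
    classical
    let g : MvPolynomial (Fin n) ℂ := ∑ Q ∈ T.support with Q ∈ S, monomial Q (coeff Q T)
    have hg (Q) : coeff Q g = if Q ∈ S then coeff Q T else 0 := by
      simp only [g, coeff_sum, coeff_monomial, Finset.sum_ite_eq', Finset.mem_filter,
        mem_support_iff]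
      by_cases h : coeff Q T = 0 <;> simp [h]
    refine ⟨g, mem_monoIdeal.2 fun Q hQ => by rw [hg, if_neg hQ], ?_⟩
    have h1 : (fun z => eval z (T - g)) =O[𝓝 0] fun z : Fin n → ℂ => ‖z‖ ^ d := by
      refine isBigO_eval_of_coeff fun Q hQ => ?_
      rw [coeff_sub, hg]
      split_ifs with hS
      · exact sub_self _
      · rw [h Q hS hQ, sub_zero]
    simpa using hT.add h1

namespace HasTaylor

variable {f g : (Fin n → ℂ) → ℂ}

theorem eval (T : MvPolynomial (Fin n) ℂ) : HasTaylor fun z => eval z T := fun d =>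
  ⟨T, by simpa using isBigO_zero _ _⟩

theorem isBigO_one (hf : HasTaylor f) : f =O[𝓝 0] fun z => ‖z‖ ^ 0 := by
  obtain ⟨T, hT⟩ := hf 0
  simpa using hT.add (isBigO_one_eval T)

theorem add (hf : HasTaylor f) (hg : HasTaylor g) : HasTaylor fun z => f z + g z := fun d => by
  obtain ⟨T, hT⟩ := hf d
  obtain ⟨U, hU⟩ := hg d
  refine ⟨T + U, (hT.add hU).congr_left fun z => ?_⟩
  rw [map_add]; ring

theorem mul (hf : HasTaylor f) (hg : HasTaylor g) : HasTaylor fun z => f z * g z := fun d => by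
  obtain ⟨T, hT⟩ := hf d
  obtain ⟨U, hU⟩ := hg d
  refine ⟨T * U, (((hT.mul hg.isBigO_one).congr_right fun z => ?_).add
    (((isBigO_one_eval T).mul hU).congr_right fun z => ?_)).congr_left fun z => ?_⟩
  · rw [pow_zero, mul_one]
  · rw [pow_zero, one_mul]
  · rw [map_mul]; ring

theorem const (c : ℂ) : HasTaylor fun _ : Fin n → ℂ => c := by
  simpa using HasTaylor.eval (n := n) (C c)

theorem coord (a : Fin n) : HasTaylor fun z : Fin n → ℂ => z a := by
  simpa using HasTaylor.eval (n := n) (X a)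

theorem sub (hf : HasTaylor f) (hg : HasTaylor g) : HasTaylor fun z => f z - g z := by
  simpa [sub_eq_add_neg] using hf.add ((HasTaylor.const (-1)).mul hg)

theorem sum {ι : Type*} (s : Finset ι) {u : ι → (Fin n → ℂ) → ℂ} (hu : ∀ i ∈ s, HasTaylor (u i)) :
    HasTaylor fun z => ∑ i ∈ s, u i z := by
  classical
  induction s using Finset.induction_on with
  | empty => simpa using HasTaylor.const 0
  | insert i s hi ih =>
    simp_rw [Finset.sum_insert hi]
    exact (hu i (by simp)).add (ih fun j hj => hu j (by simp [hj]))

theorem prod {ι : Type*} (s : Finset ι) {u : ι → (Fin n → ℂ) → ℂ} (hu : ∀ i ∈ s, HasTaylor (u i)) :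
    HasTaylor fun z => ∏ i ∈ s, u i z := by
  classical
  induction s using Finset.induction_on with
  | empty => simpa using HasTaylor.const 1
  | insert i s hi ih =>
    simp_rw [Finset.prod_insert hi]
    exact (hu i (by simp)).mul (ih fun j hj => hu j (by simp [hj]))

end HasTaylor

namespace MemUpTo

variable {S : UpperSet (Fin n →₀ ℕ)} {d e : ℕ} {f g : (Fin n → ℂ) → ℂ}

theorem of_isBigO (hf : f =O[𝓝 0] fun z => ‖z‖ ^ d) : MemUpTo S d f :=
  ⟨0, Ideal.zero_mem _, by simpa using hf⟩

theorem zero : MemUpTo S d fun _ => 0 := of_isBigO (isBigO_zero _ _)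

theorem add (hf : MemUpTo S d f) (hg : MemUpTo S d g) : MemUpTo S d fun z => f z + g z := by
  obtain ⟨p, hp, hfp⟩ := hf
  obtain ⟨q, hq, hgq⟩ := hg
  refine ⟨p + q, Ideal.add_mem _ hp hq, (hfp.add hgq).congr_left fun z => ?_⟩
  rw [map_add]; ring

theorem mul (hf : MemUpTo S d f) (hg : HasTaylor g) (hge : g =O[𝓝 0] fun z => ‖z‖ ^ e) :
    MemUpTo S (d + e) fun z => f z * g z := by
  obtain ⟨p, hp, hfp⟩ := hf
  obtain ⟨T, hT⟩ := hg (d + e)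
  refine ⟨p * T, Ideal.mul_mem_right _ _ hp, ?_⟩
  have h := ((hfp.mul hge).congr_right fun z => (pow_add _ _ _).symm).add
    (((isBigO_one_eval p).mul hT).congr_right fun z => by rw [pow_zero, one_mul])
  refine h.congr_left fun z => ?_
  rw [map_mul]; ring

theorem const_mul (hf : MemUpTo S d f) (c : ℂ) : MemUpTo S d fun z => c * f z := by
  simpa [mul_comm] using hf.mul (HasTaylor.const c) (e := 0) (HasTaylor.const c).isBigO_one

theorem sub (hf : MemUpTo S d f) (hg : MemUpTo S d g) : MemUpTo S d fun z => f z - g z := by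
  simpa [sub_eq_add_neg] using hf.add (hg.const_mul (-1))

theorem mono (hf : MemUpTo S e f) (h : d ≤ e) : MemUpTo S d f := by
  obtain ⟨p, hp, hfp⟩ := hf
  exact ⟨p, hp, isBigO_pow_mono hfp h⟩

theorem sum {ι : Type*} (s : Finset ι) {u : ι → (Fin n → ℂ) → ℂ}
    (hu : ∀ i ∈ s, MemUpTo S d (u i)) : MemUpTo S d fun z => ∑ i ∈ s, u i z := by
  classical
  induction s using Finset.induction_on with
  | empty => simpa using MemUpTo.zero
  | insert i s hi ih =>
    simp_rw [Finset.sum_insert hi]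
    exact (hu i (by simp)).add (ih fun j hj => hu j (by simp [hj]))

theorem congr (hf : MemUpTo S d f) (h : f =ᶠ[𝓝 0] g) : MemUpTo S d g := by
  obtain ⟨p, hp, hfp⟩ := hf
  exact ⟨p, hp, hfp.congr' (h.mono fun z hz => by simp only [hz]) EventuallyEq.rfl⟩

end MemUpTo

theorem isBigO_comp {u : (Fin n → ℂ) → (Fin n → ℂ)} {f : (Fin n → ℂ) → ℂ} {d : ℕ}
    (hf : f =O[𝓝 0] fun z => ‖z‖ ^ d) (hu : ∀ a, (fun z => u z a) =O[𝓝 0] fun z => ‖z‖ ^ 1) :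
    (fun z => f (u z)) =O[𝓝 0] fun z => ‖z‖ ^ d := by
  have h1 : u =O[𝓝 0] fun z => ‖z‖ := by
    rw [isBigO_pi]; simpa using hu
  have h2 : Tendsto u (𝓝 0) (𝓝 0) :=
    h1.trans_tendsto (by simpa using (continuous_norm (E := Fin n → ℂ)).tendsto 0)
  exact (hf.comp_tendsto h2).trans (h1.norm_left.pow d)

/-- Perturbing the factors of a product of `k + 1` factors that vanish at the origin by elements of
order `d` modulo the ideal changes the product by an element of order `d + k` modulo the ideal. -/
theorem memUpTo_prod_sub_prod {S : UpperSet (Fin n →₀ ℕ)} {d : ℕ}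
    {u v : Fin n → (Fin n → ℂ) → ℂ} (hu : ∀ a, HasTaylor (u a)) (hv : ∀ a, HasTaylor (v a))
    (hu1 : ∀ a, u a =O[𝓝 0] fun z => ‖z‖ ^ 1) (hv1 : ∀ a, v a =O[𝓝 0] fun z => ‖z‖ ^ 1)
    (hvd : ∀ a, MemUpTo S d (v a)) (k : ℕ) (w : Fin (k + 1) → Fin n) :
    MemUpTo S (d + k) fun z => ∏ i, (u (w i) z + v (w i) z) - ∏ i, u (w i) z := by
  induction k with
  | zero => simpa using hvd (w 0)
  | succ k ih =>
    have h1 : (fun z => ∏ i : Fin (k + 1), (u (w i.succ) z + v (w i.succ) z)) =O[𝓝 0]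
        fun z : Fin n → ℂ => ‖z‖ ^ (k + 1) := by
      simpa using isBigO_prod_pow Finset.univ
        (fun (i : Fin (k + 1)) z => u (w i.succ) z + v (w i.succ) z) (fun _ => 1)
        (fun i _ => (hu1 _).add (hv1 _))
    have h2 := (hvd (w 0)).mul (HasTaylor.prod Finset.univ
      fun (i : Fin (k + 1)) _ => (hu (w i.succ)).add (hv (w i.succ))) h1
    have h3 := (ih (fun i => w i.succ)).mul (hu (w 0)) (hu1 (w 0))
    refine (h2.add h3).congr (Eventually.of_forall fun z => ?_)
    simp only [Fin.prod_univ_succ (n := k + 1)]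
    ring

/-! ### Convergent expansions in words -/

/-- The polynomial `∑_{k < d} ∑_w c_{k,w} x_{w_0} ⋯ x_{w_{k+1}}`, over words `w` of length `k + 2` in
the variables: the part of degree `2, …, d + 1` of a series. Words are not taken up to
permutation, so several coefficients may belong to the same monomial. -/
def tailPoly (c : ∀ k : ℕ, (Fin (k + 2) → Fin n) → ℂ) (d : ℕ) : MvPolynomial (Fin n) ℂ :=
  ∑ k ∈ Finset.range d, ∑ w : Fin (k + 2) → Fin n, C (c k w) * ∏ i, X (w i)

/-- `f` has the asymptotic expansion `∑_a L_a z_a + ∑_{k, w} c_{k,w} z_{w_0} ⋯ z_{w_{k+1}}` at the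
origin. -/
def HasTail (f : (Fin n → ℂ) → ℂ) (L : Fin n → ℂ) (c : ∀ k : ℕ, (Fin (k + 2) → Fin n) → ℂ) :
    Prop :=
  ∀ d : ℕ, (fun z => f z - ∑ a, L a * z a - eval z (tailPoly c d)) =O[𝓝 0]
    fun z => ‖z‖ ^ (d + 2)

theorem eval_tailPoly (c : ∀ k : ℕ, (Fin (k + 2) → Fin n) → ℂ) (d : ℕ) (z : Fin n → ℂ) :
    eval z (tailPoly c d) = ∑ k ∈ Finset.range d, ∑ w : Fin (k + 2) → Fin n,
      c k w * ∏ i, z (w i) := by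
  simp [tailPoly, map_sum, map_prod]

theorem multilinear_apply_diag (k : ℕ) (p : ContinuousMultilinearMap ℂ (fun _ : Fin k => Fin n → ℂ) ℂ)
    (z : Fin n → ℂ) :
    p (fun _ => z) = ∑ w : Fin k → Fin n, p (fun i => Pi.single (w i) 1) * ∏ i, z (w i) := by
  classical
  have hz : (fun _ : Fin k => z) = fun _ => ∑ a, z a • (Pi.single a 1 : Fin n → ℂ) := by
    funext i b
    simp [Finset.sum_apply, Pi.single_apply]
  rw [hz, p.map_sum]
  refine Finset.sum_congr rfl fun w _ => ?_
  rw [p.map_smul_univ, smul_eq_mul, mul_comm]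

/-- The Taylor series of a function that is holomorphic near the origin, indexed by words, has
geometrically bounded coefficients. -/
theorem exists_hasTail {f : (Fin n → ℂ) → ℂ} {L : (Fin n → ℂ) →L[ℂ] ℂ} (hf : AnalyticAt ℂ f 0)
    (hf0 : f 0 = 0) (hL : HasFDerivAt f L 0) :
    ∃ (c : ∀ k : ℕ, (Fin (k + 2) → Fin n) → ℂ) (M A : ℝ), 0 ≤ M ∧ 0 ≤ A ∧
      (∀ k w, ‖c k w‖ ≤ M * A ^ k) ∧ HasTail f (fun a => L (Pi.single a 1)) c := by
  obtain ⟨p, hp⟩ := hf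
  obtain ⟨M, A, hM, hA, hMA⟩ := p.le_mul_pow_of_radius_pos hp.radius_pos
  refine ⟨fun k w => p (k + 2) fun i => Pi.single (w i) 1, M * A ^ 2, A, by positivity, hA.le,
    fun k w => ?_, fun d => ?_⟩
  · calc _ ≤ ‖p (k + 2)‖ * ∏ i, ‖(Pi.single (w i) 1 : Fin n → ℂ)‖ := (p (k + 2)).le_opNorm _
      _ = ‖p (k + 2)‖ := by simp [Pi.norm_single]
      _ ≤ M * A ^ (k + 2) := hMA _
      _ = _ := by ring
  · have h := hp.isBigO_sub_partialSum_pow (d + 2)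
    refine h.congr_left fun z => ?_
    have h0 : p 0 (fun _ => z) = 0 := by
      rw [← hf0]; exact hp.coeff_zero _
    have h1 : p 1 (fun _ => z) = ∑ a, L (Pi.single a 1) * z a := by
      have h2 := hp.hasFDerivAt.unique hL
      have h3 : p 1 (fun _ => z) = L z := by
        rw [← h2]
        simp only [continuousMultilinearCurryFin1_apply]
        congr 1
      have hz : z = ∑ a, z a • (Pi.single a 1 : Fin n → ℂ) := by
        funext b
        simp [Finset.sum_apply, Pi.single_apply]
      rw [h3]
      conv_lhs => rw [hz]
      simp [map_sum, mul_comm]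
    rw [zero_add, FormalMultilinearSeries.partialSum, Finset.sum_range_succ', Finset.sum_range_succ',
      h0, h1, eval_tailPoly]
    simp_rw [multilinear_apply_diag (_ + 1 + 1)]
    ring

theorem analyticAt_conj_comp_star {f : (Fin n → ℂ) → ℂ} (hf : AnalyticAt ℂ f 0) :
    AnalyticAt ℂ (fun z => (starRingEnd ℂ) (f (star z))) 0 := by
  obtain ⟨p, r, hp⟩ := hf
  let q : FormalMultilinearSeries ℂ (Fin n → ℂ) ℂ := fun k =>
    MultilinearMap.mkContinuous
      { toFun := fun v => (starRingEnd ℂ) (p k fun i => star (v i))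
        map_update_add' := fun v i x y => by
          have h (x) : (fun j => star (Function.update v i x j)) =
              Function.update (fun j => star (v j)) i (star x) := by
            funext j
            rcases eq_or_ne j i with rfl | hj <;> simp [*]
          simp only [h, star_add, (p k).map_update_add, map_add]
        map_update_smul' := fun v i x y => by
          have h (x) : (fun j => star (Function.update v i x j)) =
              Function.update (fun j => star (v j)) i (star x) := by
            funext j
            rcases eq_or_ne j i with rfl | hj <;> simp [*]
          simp only [h, star_smul, (p k).map_update_smul, smul_eq_mul, map_mul]
          simp } ‖p k‖ fun v => by
            simpa using (p k).le_opNorm fun i => star (v i)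
  have hq (k) (v : Fin k → Fin n → ℂ) : q k v = (starRingEnd ℂ) (p k fun i => star (v i)) := rfl
  have hqn (k) : ‖q k‖ ≤ ‖p k‖ := MultilinearMap.mkContinuous_norm_le _ (norm_nonneg _) _
  refine ⟨q, r, ⟨hp.r_le.trans (FormalMultilinearSeries.radius_le_of_le fun k => hqn k),
    hp.r_pos, fun {y} hy => ?_⟩⟩
  have hy' : star y ∈ Metric.eball (0 : Fin n → ℂ) r := by
    rw [mem_eball_zero_iff] at hy ⊢
    simpa [enorm_eq_nnnorm] using hy
  have := (hp.hasSum hy').map (starRingEnd ℂ) Complex.continuous_conj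
  simpa [hq, Function.comp_def] using this

theorem exists_word (k : ℕ) (Q : Fin n →₀ ℕ) (hQ : Q.degree = k) :
    ∃ w : Fin k → Fin n, ∑ i, Finsupp.single (w i) 1 = Q := by
  induction k generalizing Q with
  | zero =>
    rw [Finsupp.degree_eq_zero_iff] at hQ
    exact ⟨Fin.elim0, by simp [hQ]⟩
  | succ k ih =>
    have hne : Q ≠ 0 := by rintro rfl; simp at hQ
    obtain ⟨a, ha⟩ := Finsupp.ne_iff.1 hne
    have hle : Finsupp.single a 1 ≤ Q := by
      rw [Finsupp.single_le_iff]; exact Nat.one_le_iff_ne_zero.2 ha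
    have hsub := add_tsub_cancel_of_le hle
    have hd : (Q - Finsupp.single a 1).degree = k := by
      have := congrArg Finsupp.degree hsub
      rw [map_add, Finsupp.degree_single] at this
      omega
    obtain ⟨w, hw⟩ := ih _ hd
    exact ⟨Fin.cons a w, by rw [Fin.sum_univ_succ]; simpa [hw] using hsub⟩

/-- A formal power series with geometrically bounded coefficients is the Taylor series of a function
that is holomorphic near the origin. -/
theorem exists_analyticAt_of_coeff (ψ : (Fin n →₀ ℕ) → ℂ) (M A : ℝ) (hM : 0 ≤ M) (hA : 0 ≤ A)
    (hψ : ∀ Q, ‖ψ Q‖ ≤ M * A ^ Q.degree) :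
    ∃ f : (Fin n → ℂ) → ℂ, AnalyticAt ℂ f 0 ∧ ∀ (d : ℕ) (T : MvPolynomial (Fin n) ℂ),
      (∀ Q : Fin n →₀ ℕ, Q.degree < d → coeff Q T = ψ Q) →
      (fun z => f z - eval z T) =O[𝓝 0] fun z => ‖z‖ ^ d := by
  classical
  have hex (k : ℕ) (Q : Fin n →₀ ℕ) : ∃ w : Option (Fin k → Fin n), Q.degree = k →
      ∃ w', w = some w' ∧ ∑ i, Finsupp.single (w' i) 1 = Q := by
    by_cases h : Q.degree = k
    · obtain ⟨w, hw⟩ := exists_word k Q h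
      exact ⟨some w, fun _ => ⟨w, rfl, hw⟩⟩
    · exact ⟨none, fun h' => absurd h' h⟩
  choose ch hch using hex
  -- each coefficient is placed at one chosen word among those representing its monomial
  let cnt (k : ℕ) (w : Fin k → Fin n) : Fin n →₀ ℕ := ∑ i, Finsupp.single (w i) 1
  have hcnt (k) (w : Fin k → Fin n) : (cnt k w).degree = k := by simp [cnt, map_sum]
  let c (k : ℕ) (w : Fin k → Fin n) : ℂ := if ch k (cnt k w) = some w then ψ (cnt k w) else 0
  have hc (k w) : ‖c k w‖ ≤ M * A ^ k := by
    simp only [c]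
    split_ifs
    · simpa [hcnt] using hψ (cnt k w)
    · simp; positivity
  let m (k : ℕ) (w : Fin k → Fin n) : ContinuousMultilinearMap ℂ (fun _ : Fin k => Fin n → ℂ) ℂ :=
    (ContinuousMultilinearMap.mkPiAlgebra ℂ (Fin k) ℂ).compContinuousLinearMap
      fun i => ContinuousLinearMap.proj (w i)
  have hm (k w) : ‖m k w‖ ≤ 1 := by
    refine ContinuousMultilinearMap.opNorm_le_bound zero_le_one fun v => ?_
    simp only [m, ContinuousMultilinearMap.compContinuousLinearMap_apply,
      ContinuousMultilinearMap.mkPiAlgebra_apply, ContinuousLinearMap.proj_apply, norm_prod, one_mul]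
    exact Finset.prod_le_prod (fun i _ => norm_nonneg _) fun i _ => norm_le_pi_norm _ _
  let p : FormalMultilinearSeries ℂ (Fin n → ℂ) ℂ := fun k => ∑ w, c k w • m k w
  have hp (k) : ‖p k‖ ≤ M * (n * A) ^ k := by
    calc ‖p k‖ ≤ ∑ w : Fin k → Fin n, ‖c k w • m k w‖ := norm_sum_le _ _
      _ ≤ ∑ w : Fin k → Fin n, M * A ^ k := Finset.sum_le_sum fun w _ => by
          rw [norm_smul]
          exact (mul_le_of_le_one_right (norm_nonneg _) (hm k w)).trans (hc k w)
      _ = _ := by simp [mul_pow]; ring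
  have hB : 0 ≤ n * A := by positivity
  let r : NNReal := ⟨1 / (n * A + 1), by positivity⟩
  have hr : 0 < r := NNReal.coe_pos.1 (by change (0 : ℝ) < 1 / (n * A + 1); positivity)
  have hrad : (r : ENNReal) ≤ p.radius := by
    refine p.le_radius_of_bound M fun k => ?_
    calc ‖p k‖ * (r : ℝ) ^ k ≤ M * (n * A) ^ k * (1 / (n * A + 1)) ^ k :=
          mul_le_mul_of_nonneg_right (hp k) (by positivity)
      _ = M * (n * A / (n * A + 1)) ^ k := by rw [mul_assoc, ← mul_pow, mul_one_div]
      _ ≤ M * 1 := by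
        gcongr
        exact pow_le_one₀ (by positivity) ((div_le_one (by positivity)).2 (by linarith))
      _ = M := mul_one M
  have hball := p.hasFPowerSeriesOnBall ((ENNReal.coe_pos.2 hr).trans_le hrad)
  refine ⟨p.sum, hball.analyticAt, fun d T hT => ?_⟩
  have h1 := hball.hasFPowerSeriesAt.isBigO_sub_partialSum_pow d
  let T' : MvPolynomial (Fin n) ℂ := ∑ k ∈ Finset.range d, ∑ w, C (c k w) * ∏ i, X (w i)
  have hT' (z) : p.partialSum d z = eval z T' := by
    simp [FormalMultilinearSeries.partialSum, T', p, m, map_sum, map_prod]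
  have hcoeff : ∀ Q : Fin n →₀ ℕ, Q.degree < d → coeff Q (T' - T) = 0 := by
    intro Q hQ
    have hX (k) (w : Fin k → Fin n) :
        C (c k w) * ∏ i, X (w i) = monomial (cnt k w) (c k w) := by
      have : ∏ i, (X (w i) : MvPolynomial (Fin n) ℂ) = monomial (cnt k w) 1 := by
        simp only [X, cnt, monomial_sum_one]
      rw [this, C_mul_monomial, mul_one]
    rw [coeff_sub, hT Q hQ, sub_eq_zero]
    simp only [T', hX, coeff_sum, coeff_monomial]
    obtain ⟨w, hw, hwQ⟩ := hch _ Q rfl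
    rw [Finset.sum_eq_single_of_mem Q.degree (Finset.mem_range.2 hQ), Finset.sum_eq_single w]
    · simp only [cnt, hwQ, if_true, c, hw]
    · intro w' _ hne
      split_ifs with h
      · simp only [c, h, hw]
        rw [if_neg]
        simpa using hne.symm
      · rfl
    · simp
    · intro k _ hk
      refine Finset.sum_eq_zero fun w' _ => if_neg ?_
      rintro rfl
      exact hk (hcnt k w').symm
  have h2 := isBigO_eval_of_coeff hcoeff
  refine (h1.add h2).congr_left fun z => ?_
  rw [zero_add, hT', map_sub]
  ring

namespace HasTail

variable {f : (Fin n → ℂ) → ℂ} {L : Fin n → ℂ} {c : ∀ k : ℕ, (Fin (k + 2) → Fin n) → ℂ}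

theorem isBigO_sub_linear (hf : HasTail f L c) :
    (fun z => f z - ∑ a, L a * z a) =O[𝓝 0] fun z => ‖z‖ ^ 2 := by
  simpa [tailPoly] using hf 0

theorem isBigO (hf : HasTail f L c) : f =O[𝓝 0] fun z => ‖z‖ ^ 1 := by
  have h1 : (fun z : Fin n → ℂ => ∑ a, L a * z a) =O[𝓝 0] fun z => ‖z‖ ^ 1 :=
    IsBigO.fun_sum fun a _ => (isBigO_coord a).const_mul_left _
  simpa using (isBigO_pow_mono hf.isBigO_sub_linear one_le_two).add h1

theorem comp_isBigO (hf : HasTail f L c) {u : (Fin n → ℂ) → (Fin n → ℂ)}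
    (hu : ∀ a, (fun z => u z a) =O[𝓝 0] fun z => ‖z‖ ^ 1) (d : ℕ) :
    (fun z => f (u z) - ∑ a, L a * u z a - eval (u z) (tailPoly c d)) =O[𝓝 0]
      fun z => ‖z‖ ^ (d + 2) :=
  isBigO_comp (hf d) hu

theorem comp_hasTaylor (hf : HasTail f L c) {u : (Fin n → ℂ) → (Fin n → ℂ)}
    (hut : ∀ a, HasTaylor fun z => u z a)
    (hu : ∀ a, (fun z => u z a) =O[𝓝 0] fun z => ‖z‖ ^ 1) : HasTaylor fun z => f (u z) := by
  intro d
  have h1 : HasTaylor fun z => ∑ a, L a * u z a + eval (u z) (tailPoly c d) := by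
    simp_rw [eval_tailPoly]
    exact (HasTaylor.sum _ fun a _ => (HasTaylor.const _).mul (hut a)).add
      (HasTaylor.sum _ fun k _ => HasTaylor.sum _ fun w _ => (HasTaylor.const _).mul
        (HasTaylor.prod _ fun i _ => hut _))
  obtain ⟨T, hT⟩ := h1 d
  refine ⟨T, ((isBigO_pow_mono (hf.comp_isBigO hu d) (Nat.le_add_right d 2)).add hT).congr_left
    fun z => ?_⟩
  ring

theorem hasTaylor (hf : HasTail f L c) : HasTaylor f :=
  hf.comp_hasTaylor (u := fun z => z) HasTaylor.coord isBigO_coord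

/-- Newton's step modulo the ideal: if `v` belongs to the ideal up to order `d`, then
`f (u + v) - f u` is `Df(0) v` up to order `d + 1` modulo the ideal. -/
theorem memUpTo_sub {S : UpperSet (Fin n →₀ ℕ)} {d : ℕ} (hf : HasTail f L c)
    {u v : Fin n → (Fin n → ℂ) → ℂ} (hu : ∀ a, HasTaylor (u a)) (hv : ∀ a, HasTaylor (v a))
    (hu1 : ∀ a, u a =O[𝓝 0] fun z => ‖z‖ ^ 1) (hv1 : ∀ a, v a =O[𝓝 0] fun z => ‖z‖ ^ 1)
    (hvd : ∀ a, MemUpTo S d (v a)) :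
    MemUpTo S (d + 1) fun z => f (fun a => u a z + v a z) - f (fun a => u a z) -
      ∑ a, L a * v a z := by
  have h1 := hf.comp_isBigO (u := fun z a => u a z + v a z) (fun a => (hu1 a).add (hv1 a)) d
  have h2 := hf.comp_isBigO (u := fun z a => u a z) hu1 d
  have h3 : MemUpTo S (d + 1) fun z =>
      eval (fun a => u a z + v a z) (tailPoly c d) - eval (fun a => u a z) (tailPoly c d) := by
    simp_rw [eval_tailPoly, ← Finset.sum_sub_distrib, ← mul_sub]
    exact MemUpTo.sum _ fun k _ => MemUpTo.sum _ fun w _ => MemUpTo.const_mul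
      ((memUpTo_prod_sub_prod hu hv hu1 hv1 hvd (k + 1) w).mono (by omega)) _
  refine (((MemUpTo.of_isBigO h1).sub (MemUpTo.of_isBigO h2)).mono (Nat.le_succ _)
    |>.add h3).congr (Eventually.of_forall fun z => ?_)
  simp only [mul_add, Finset.sum_add_distrib]
  ring

end HasTail

/-! ### Formal linearization modulo a monomial ideal -/

/-- The polynomial `T(ν_1 x_1, …, ν_n x_n)`. -/
def dilate (ν : Fin n → ℂ) (T : MvPolynomial (Fin n) ℂ) : MvPolynomial (Fin n) ℂ :=
  ∑ Q ∈ T.support, monomial Q (monomialFun Q ν * coeff Q T)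

theorem coeff_dilate (ν : Fin n → ℂ) (T : MvPolynomial (Fin n) ℂ) (Q : Fin n →₀ ℕ) :
    coeff Q (dilate ν T) = monomialFun Q ν * coeff Q T := by
  classical
  simp only [dilate, coeff_sum, coeff_monomial, Finset.sum_ite_eq', mem_support_iff]
  by_cases h : coeff Q T = 0 <;> simp [h]

theorem eval_dilate (ν : Fin n → ℂ) (T : MvPolynomial (Fin n) ℂ) (z : Fin n → ℂ) :
    eval z (dilate ν T) = eval (ν * z) T := by
  rw [eval_eq' (ν * z), dilate, map_sum]
  refine Finset.sum_congr rfl fun Q _ => ?_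
  rw [eval_monomial, Finsupp.prod_fintype _ _ (by simp)]
  simp only [monomialFun, Pi.mul_apply, mul_pow, Finset.prod_mul_distrib]
  ring

theorem eval_bind₁ (Ψ : Fin n → MvPolynomial (Fin n) ℂ) (p : MvPolynomial (Fin n) ℂ)
    (z : Fin n → ℂ) : eval z (bind₁ Ψ p) = eval (fun a => eval z (Ψ a)) p :=
  eval₂Hom_bind₁ (RingHom.id ℂ) z Ψ p

theorem isBigO_dilation (ν : Fin n → ℂ) (a : Fin n) :
    (fun z : Fin n → ℂ => (ν * z) a) =O[𝓝 0] fun z => ‖z‖ ^ 1 :=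
  (isBigO_coord a).const_mul_left (ν a)

theorem isBigO_sub_eval_dilate {f : (Fin n → ℂ) → ℂ} {T : MvPolynomial (Fin n) ℂ} {d : ℕ}
    (hT : (fun z => f z - eval z T) =O[𝓝 0] fun z => ‖z‖ ^ d) (ν : Fin n → ℂ) :
    (fun z => f (ν * z) - eval z (dilate ν T)) =O[𝓝 0] fun z => ‖z‖ ^ d := by
  simp_rw [eval_dilate]
  exact isBigO_comp hT (isBigO_dilation ν)

theorem HasTaylor.dilation {f : (Fin n → ℂ) → ℂ} (hf : HasTaylor f) (ν : Fin n → ℂ) :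
    HasTaylor fun z => f (ν * z) := fun d =>
  let ⟨T, hT⟩ := hf d
  ⟨dilate ν T, isBigO_sub_eval_dilate hT ν⟩

/-- `Ψ` has Taylor polynomials of every order at the origin, and fixes the origin: `Ψ(z) = O(‖z‖)`. -/
structure IsJet (Ψ : (Fin n → ℂ) → Fin n → ℂ) : Prop where
  hasTaylor : ∀ a, HasTaylor fun z => Ψ z a
  isBigO : ∀ a, (fun z => Ψ z a) =O[𝓝 0] fun z => ‖z‖ ^ 1

theorem IsJet.dilation {Ψ : (Fin n → ℂ) → Fin n → ℂ} (hΨ : IsJet Ψ) (ν : Fin n → ℂ) :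
    IsJet fun z => Ψ (ν * z) :=
  ⟨fun a => (hΨ.hasTaylor a).dilation ν, fun a => isBigO_comp (hΨ.isBigO a) (isBigO_dilation ν)⟩

theorem IsJet.tendsto {Ψ : (Fin n → ℂ) → Fin n → ℂ} (hΨ : IsJet Ψ) : Tendsto Ψ (𝓝 0) (𝓝 0) := by
  have h1 : Ψ =O[𝓝 0] fun z => ‖z‖ := by
    rw [isBigO_pi]; simpa using hΨ.isBigO
  exact h1.trans_tendsto (by simpa using (continuous_norm (E := Fin n → ℂ)).tendsto 0)

section Conjugacy

variable {ι : Type*} {F : ι → (Fin n → ℂ) → Fin n → ℂ} {μ : ι → Fin n → ℂ}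
  {c : ι → Fin n → ∀ k : ℕ, (Fin (k + 2) → Fin n) → ℂ} {S : UpperSet (Fin n →₀ ℕ)}

/-- The `j`-th component of `F ∘ Ψ - Ψ ∘ diag(ν)`. -/
def defect (F : (Fin n → ℂ) → Fin n → ℂ) (ν : Fin n → ℂ) (Ψ : (Fin n → ℂ) → Fin n → ℂ)
    (j : Fin n) (z : Fin n → ℂ) : ℂ :=
  F (Ψ z) j - Ψ (ν * z) j

theorem IsJet.comp {G : (Fin n → ℂ) → Fin n → ℂ} {L : Fin n → Fin n → ℂ}
    {b : Fin n → ∀ k : ℕ, (Fin (k + 2) → Fin n) → ℂ} (hG : ∀ j, HasTail (fun z => G z j) (L j) (b j))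
    {Ψ : (Fin n → ℂ) → Fin n → ℂ} (hΨ : IsJet Ψ) : IsJet fun z => G (Ψ z) :=
  ⟨fun j => (hG j).comp_hasTaylor hΨ.hasTaylor hΨ.isBigO,
    fun j => isBigO_comp (hG j).isBigO hΨ.isBigO⟩

theorem sum_single_mul (j : Fin n) (x : ℂ) (v : Fin n → ℂ) :
    ∑ a, (Pi.single j x : Fin n → ℂ) a * v a = x * v j := by
  simp [Pi.single_apply]

theorem isJet_defect (hF : ∀ q j, HasTail (fun z => F q z j) (Pi.single j (μ q j)) (c q j))
    {Ψ : (Fin n → ℂ) → Fin n → ℂ} (hΨ : IsJet Ψ) (q : ι) :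
    IsJet fun z j => defect (F q) (μ q) Ψ j z :=
  ⟨fun j => ((IsJet.comp (hF q) hΨ).hasTaylor j).sub ((hΨ.dilation (μ q)).hasTaylor j),
    fun j => ((IsJet.comp (hF q) hΨ).isBigO j).sub ((hΨ.dilation (μ q)).isBigO j)⟩

/-- Commutation of `F q` and `F r` forces the leading terms of the defects of an approximate conjugacy to
satisfy the cocycle relation that makes the linearized equations for `q` and `r` compatible. -/
theorem defect_comm (hF : ∀ q j, HasTail (fun z => F q z j) (Pi.single j (μ q j)) (c q j))
    (hcomm : ∀ q r, ∀ᶠ z in 𝓝 (0 : Fin n → ℂ), F q (F r z) = F r (F q z))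
    {Ψ : (Fin n → ℂ) → Fin n → ℂ} (hΨ : IsJet Ψ) {d : ℕ}
    (hd : ∀ q j, MemUpTo S d (defect (F q) (μ q) Ψ j)) (q r : ι) (j : Fin n) :
    MemUpTo S (d + 1) fun z =>
      (defect (F q) (μ q) Ψ j (μ r * z) + μ q j * defect (F r) (μ r) Ψ j z) -
      (defect (F r) (μ r) Ψ j (μ q * z) + μ r j * defect (F q) (μ q) Ψ j z) := by
  have key (q r : ι) : MemUpTo S (d + 1) fun z => F q (F r (Ψ z)) j - Ψ (μ q * (μ r * z)) j -
      (defect (F q) (μ q) Ψ j (μ r * z) + μ q j * defect (F r) (μ r) Ψ j z) := by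
    have hr := isJet_defect hF hΨ r
    have h := (hF q j).memUpTo_sub (u := fun a z => Ψ (μ r * z) a)
      (v := fun a z => defect (F r) (μ r) Ψ a z) (hΨ.dilation (μ r)).hasTaylor hr.hasTaylor
      (hΨ.dilation (μ r)).isBigO hr.isBigO (hd r)
    refine h.congr (Eventually.of_forall fun z => ?_)
    have e : (fun a => Ψ (μ r * z) a + defect (F r) (μ r) Ψ a z) = F r (Ψ z) := by
      funext a; simp [defect]
    simp only [e, sum_single_mul]
    simp only [defect]
    ring
  refine ((key r q).sub (key q r)).congr ?_
  filter_upwards [hΨ.tendsto.eventually (hcomm q r)] with z hz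
  rw [hz, mul_left_comm (μ q) (μ r) z]
  ring

/-- `Ψ` is a polynomial solution of degree at most `d + 1` of the conjugacy equations modulo the ideal of
`S`: it is tangent to the identity, its other monomials are not in the ideal, and all defects
belong to the ideal up to order `d + 2`. -/
structure IsFormalStage (S : UpperSet (Fin n →₀ ℕ)) (F : ι → (Fin n → ℂ) → Fin n → ℂ)
    (μ : ι → Fin n → ℂ) (d : ℕ) (Ψ : Fin n → MvPolynomial (Fin n) ℂ) : Prop where
  coeff_ne_zero : ∀ j Q, coeff Q (Ψ j - X j) ≠ 0 → Q ∉ S ∧ 2 ≤ Q.degree ∧ Q.degree ≤ d + 1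
  memUpTo : ∀ q j, MemUpTo S (d + 2) (defect (F q) (μ q) (fun z a => eval z (Ψ a)) j)

theorem IsFormalStage.isJet {d : ℕ} {Ψ : Fin n → MvPolynomial (Fin n) ℂ}
    (h : IsFormalStage S F μ d Ψ) : IsJet fun z a => eval z (Ψ a) := by
  refine ⟨fun a => HasTaylor.eval _, fun a => isBigO_eval_of_coeff fun Q hQ => ?_⟩
  by_contra hne
  have hX : coeff Q (X a : MvPolynomial (Fin n) ℂ) = 0 := by
    rw [coeff_X, if_neg]
    rintro rfl
    simp at hQ
  have := (h.coeff_ne_zero a Q (by rwa [coeff_sub, hX, sub_zero])).2.1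
  omega

theorem isFormalStage_X
    (hF : ∀ q j, HasTail (fun z => F q z j) (Pi.single j (μ q j)) (c q j)) :
    IsFormalStage S F μ 0 X := by
  refine ⟨fun j Q h => absurd (by rw [sub_self, coeff_zero]) h, fun q j => ?_⟩
  refine MemUpTo.of_isBigO ((hF q j).isBigO_sub_linear.congr_left fun z => ?_)
  simp [defect, Pi.single_apply]

/-- One more degree of the conjugacy can be solved, the new coefficients being given by dividing those of
the nonlinear part of `F q ∘ Ψ` by the small divisors. -/
theorem IsFormalStage.exists_succ [Finite ι]
    (hF : ∀ q j, HasTail (fun z => F q z j) (Pi.single j (μ q j)) (c q j))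
    (hcomm : ∀ q r, ∀ᶠ z in 𝓝 (0 : Fin n → ℂ), F q (F r z) = F r (F q z))
    (hS : ∀ Q ∉ S, 2 ≤ Q.degree → ∀ j, ∃ q, monomialFun Q (μ q) ≠ μ q j)
    {d : ℕ} {Ψ : Fin n → MvPolynomial (Fin n) ℂ} (h : IsFormalStage S F μ d Ψ) :
    ∃ Ψ' : Fin n → MvPolynomial (Fin n) ℂ, IsFormalStage S F μ (d + 1) Ψ' ∧
      (∀ j Q, Q.degree ≤ d + 1 → coeff Q (Ψ' j) = coeff Q (Ψ j)) ∧
      ∀ q j, ∀ Q ∉ S, Q.degree ≤ d + 2 → (monomialFun Q (μ q) - μ q j) * coeff Q (Ψ' j) =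
        coeff Q (bind₁ Ψ (tailPoly (c q j) (d + 1))) := by
  classical
  have := Fintype.ofFinite ι
  have hΨ := h.isJet
  -- the Taylor polynomial of the defect
  let T (q : ι) (j : Fin n) : MvPolynomial (Fin n) ℂ :=
    C (μ q j) * Ψ j + bind₁ Ψ (tailPoly (c q j) (d + 1)) - dilate (μ q) (Ψ j)
  have hT (q j) : (fun z => defect (F q) (μ q) (fun z a => eval z (Ψ a)) j z - eval z (T q j)) =O[𝓝 0]
      fun z => ‖z‖ ^ (d + 3) := by
    refine ((hF q j).comp_isBigO hΨ.isBigO (d + 1)).congr_left fun z => ?_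
    simp only [sum_single_mul, defect, T, map_sub, map_add, map_mul, eval_C, eval_dilate,
      eval_bind₁]
    ring
  have hT0 (q j) (Q) (hQ : Q ∉ S) (hQd : Q.degree < d + 2) : coeff Q (T q j) = 0 :=
    (memUpTo_iff (isBigO_pow_mono (hT q j) (Nat.le_succ _))).1 (h.memUpTo q j) Q hQ hQd
  have hrel (q r j) (Q) (hQ : Q ∉ S) (hQd : Q.degree ≤ d + 2) :
      (monomialFun Q (μ r) - μ r j) * coeff Q (T q j) =
        (monomialFun Q (μ q) - μ q j) * coeff Q (T r j) := by
    have h1 := defect_comm hF hcomm hΨ h.memUpTo q r j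
    have h2 := (memUpTo_iff (T := (dilate (μ r) (T q j) + C (μ q j) * T r j) -
      (dilate (μ q) (T r j) + C (μ r j) * T q j)) ?_).1 h1 Q hQ (by omega)
    · simp only [coeff_sub, coeff_add, coeff_dilate, coeff_C_mul] at h2
      linear_combination h2
    · refine (((isBigO_sub_eval_dilate (hT q j) (μ r)).add ((hT r j).const_mul_left (μ q j))).sub
        ((isBigO_sub_eval_dilate (hT r j) (μ q)).add ((hT q j).const_mul_left (μ r j)))).congr_left
        fun z => ?_
      simp only [map_sub, map_add, map_mul, eval_C]
      ring
  -- by `hrel`, the coefficients of the homogeneous correction `η` do not depend on `q`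
  have hx (j : Fin n) (Q : Fin n →₀ ℕ) : ∃ x : ℂ,
      (Q ∉ S ∧ Q.degree = d + 2 → ∀ q, coeff Q (T q j) + (μ q j - monomialFun Q (μ q)) * x = 0) ∧
      ((∀ q, coeff Q (T q j) = 0) → x = 0) := by
    by_cases hQ : Q ∉ S ∧ Q.degree = d + 2
    · obtain ⟨q₀, hq₀⟩ := hS Q hQ.1 (by omega) j
      refine ⟨coeff Q (T q₀ j) / (monomialFun Q (μ q₀) - μ q₀ j), fun _ q => ?_,
        fun h => by rw [h, zero_div]⟩
      have hne := sub_ne_zero.2 hq₀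
      have := hrel q q₀ j Q hQ.1 hQ.2.le
      field_simp
      linear_combination this
    · exact ⟨0, fun h => absurd h hQ, fun _ => rfl⟩
  choose x hx hx0 using hx
  let η (j : Fin n) : MvPolynomial (Fin n) ℂ :=
    ∑ Q ∈ Finset.univ.biUnion fun q => (T q j).support,
      if Q ∉ S ∧ Q.degree = d + 2 then monomial Q (x j Q) else 0
  have hη (j Q) : coeff Q (η j) = if Q ∉ S ∧ Q.degree = d + 2 then x j Q else 0 := by
    have h1 (Q') : coeff Q (if Q' ∉ S ∧ Q'.degree = d + 2 then monomial Q' (x j Q') else 0) =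
        if Q' = Q then (if Q ∉ S ∧ Q.degree = d + 2 then x j Q else 0) else 0 := by
      by_cases hQQ : Q' = Q
      · subst hQQ; simp only [if_true]; split_ifs <;> simp
      · rw [if_neg hQQ]; split_ifs <;> simp [coeff_monomial, hQQ]
    simp only [η, coeff_sum, h1, Finset.sum_ite_eq']
    by_cases hm : Q ∈ Finset.univ.biUnion fun q => (T q j).support
    · rw [if_pos hm]
    · rw [if_neg hm]
      have : x j Q = 0 := hx0 j Q fun q => by
        by_contra hne
        exact hm (Finset.mem_biUnion.2 ⟨q, Finset.mem_univ _, mem_support_iff.2 hne⟩)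
      simp [this]
  have hηO (j) : (fun z => eval z (η j)) =O[𝓝 0] fun z : Fin n → ℂ => ‖z‖ ^ (d + 2) :=
    isBigO_eval_of_coeff fun Q hQ => by rw [hη, if_neg (by omega)]
  have hsolve (q j) (Q) (hQ : Q ∉ S) (hQd : Q.degree ≤ d + 2) :
      coeff Q (T q j) + (μ q j - monomialFun Q (μ q)) * coeff Q (η j) = 0 := by
    rw [hη]
    by_cases hd : Q.degree = d + 2
    · rw [if_pos ⟨hQ, hd⟩]
      exact hx j Q ⟨hQ, hd⟩ q
    · rw [if_neg (by tauto), hT0 q j Q hQ (by omega)]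
      simp
  refine ⟨fun j => Ψ j + η j, ⟨fun j Q hne => ?_, fun q j => ?_⟩, fun j Q hQ => ?_,
    fun q j Q hQ hQd => ?_⟩
  · rw [add_sub_right_comm, coeff_add] at hne
    by_cases h1 : coeff Q (Ψ j - X j) = 0
    · rw [h1, zero_add, hη] at hne
      by_cases h2 : Q ∉ S ∧ Q.degree = d + 2
      · exact ⟨h2.1, by omega, by omega⟩
      · rw [if_neg h2] at hne
        exact absurd rfl hne
    · obtain ⟨a1, a2, a3⟩ := h.coeff_ne_zero j Q h1
      exact ⟨a1, a2, by omega⟩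
  · have h1 := (hF q j).memUpTo_sub (S := S) (d := d + 2) (u := fun a z => eval z (Ψ a))
      (v := fun a z => eval z (η a)) hΨ.hasTaylor (fun a => HasTaylor.eval _)
      hΨ.isBigO (fun a => isBigO_pow_mono (hηO a) (by omega)) (fun a => MemUpTo.of_isBigO (hηO a))
    have h2 : MemUpTo S (d + 3) fun z => eval z (T q j + (C (μ q j) * η j - dilate (μ q) (η j))) := by
      refine (memUpTo_iff (T := T q j + (C (μ q j) * η j - dilate (μ q) (η j)))
        (by simpa using isBigO_zero _ _)).2 fun Q hQ hQd => ?_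
      simp only [coeff_add, coeff_sub, coeff_C_mul, coeff_dilate, ← sub_mul]
      exact hsolve q j Q hQ (by omega)
    refine ((h1.add (MemUpTo.of_isBigO (hT q j))).add h2).congr (Eventually.of_forall fun z => ?_)
    simp only [sum_single_mul, defect, map_add, map_sub, map_mul, eval_C, eval_dilate]
    ring
  · rw [coeff_add, hη, if_neg (by omega), add_zero]
  · have := hsolve q j Q hQ hQd
    simp only [T, coeff_add, coeff_sub, coeff_C_mul, coeff_dilate] at this
    rw [coeff_add]
    linear_combination -this

theorem exists_formal_conjugacy [Finite ι]
    (hF : ∀ q j, HasTail (fun z => F q z j) (Pi.single j (μ q j)) (c q j))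
    (hcomm : ∀ q r, ∀ᶠ z in 𝓝 (0 : Fin n → ℂ), F q (F r z) = F r (F q z))
    (hS : ∀ Q ∉ S, 2 ≤ Q.degree → ∀ j, ∃ q, monomialFun Q (μ q) ≠ μ q j) :
    ∃ Ψ : ℕ → Fin n → MvPolynomial (Fin n) ℂ, Ψ 0 = X ∧ (∀ d, IsFormalStage S F μ d (Ψ d)) ∧
      (∀ d j Q, Q.degree ≤ d + 1 → coeff Q (Ψ (d + 1) j) = coeff Q (Ψ d j)) ∧
      ∀ d q j, ∀ Q ∉ S, Q.degree ≤ d + 2 →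
        (monomialFun Q (μ q) - μ q j) * coeff Q (Ψ (d + 1) j) =
          coeff Q (bind₁ (Ψ d) (tailPoly (c q j) (d + 1))) := by
  choose! next h1 h2 h3 using fun (d : ℕ) (Ψ : Fin n → MvPolynomial (Fin n) ℂ)
    (h : IsFormalStage S F μ d Ψ) => h.exists_succ hF hcomm hS
  let Ψ : ℕ → Fin n → MvPolynomial (Fin n) ℂ := fun d => Nat.rec X (fun d Φ => next d Φ) d
  have hst (d) : IsFormalStage S F μ d (Ψ d) := by
    induction d with
    | zero => exact isFormalStage_X hF
    | succ d ih => exact h1 d _ ih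
  exact ⟨Ψ, rfl, hst, fun d => h2 d _ (hst d), fun d => h3 d _ (hst d)⟩

/-- The conjugacy tangent to the identity is unique modulo the ideal. -/
theorem memUpTo_sub_of_defect
    (hF : ∀ q j, HasTail (fun z => F q z j) (Pi.single j (μ q j)) (c q j))
    (hS : ∀ Q ∉ S, 2 ≤ Q.degree → ∀ j, ∃ q, monomialFun Q (μ q) ≠ μ q j)
    {Ψ Ψ' : (Fin n → ℂ) → Fin n → ℂ} (hΨ : IsJet Ψ) (hΨ' : IsJet Ψ')
    (hd : ∀ d q j, MemUpTo S d (defect (F q) (μ q) Ψ j))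
    (hd' : ∀ d q j, MemUpTo S d (defect (F q) (μ q) Ψ' j))
    (h2 : ∀ j, (fun z => Ψ' z j - Ψ z j) =O[𝓝 0] fun z => ‖z‖ ^ 2) (d : ℕ) (j : Fin n) :
    MemUpTo S d fun z => Ψ' z j - Ψ z j := by
  have hsub (j) : HasTaylor fun z => Ψ' z j - Ψ z j := (hΨ'.hasTaylor j).sub (hΨ.hasTaylor j)
  suffices h : ∀ d j, MemUpTo S (d + 2) fun z => Ψ' z j - Ψ z j from
    (h d j).mono (Nat.le_add_right _ _)
  clear d j
  intro d
  induction d with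
  | zero => exact fun j => MemUpTo.of_isBigO (h2 j)
  | succ d ih =>
    intro j
    obtain ⟨T, hT⟩ := hsub j (d + 3)
    refine (memUpTo_iff hT).2 fun Q hQ hQd => ?_
    rcases lt_or_ge Q.degree 2 with hlt | hge
    · refine coeff_eq_zero_of_isBigO_eval (((h2 j).sub (isBigO_pow_mono hT
        (by omega : 2 ≤ d + 3))).congr_left fun z => ?_) Q hlt
      ring
    · obtain ⟨q, hq⟩ := hS Q hQ hge j
      have h1 := (hF q j).memUpTo_sub (u := fun a z => Ψ z a) (v := fun a z => Ψ' z a - Ψ z a)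
        hΨ.hasTaylor hsub hΨ.isBigO (fun a => isBigO_pow_mono (h2 a) one_le_two) ih
      have h3 : MemUpTo S (d + 3) fun z =>
          (Ψ' (μ q * z) j - Ψ (μ q * z) j) - μ q j * (Ψ' z j - Ψ z j) := by
        refine ((h1.sub (hd' _ q j)).add (hd _ q j)).congr (Eventually.of_forall fun z => ?_)
        have e : (fun a => Ψ z a + (Ψ' z a - Ψ z a)) = Ψ' z := by funext a; ring
        simp only [e, sum_single_mul, defect]
        ring
      have h4 := (memUpTo_iff (T := dilate (μ q) T - C (μ q j) * T) ?_).1 h3 Q hQ hQd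
      · rw [coeff_sub, coeff_dilate, coeff_C_mul, ← sub_mul] at h4
        exact (mul_eq_zero.1 h4).resolve_left (sub_ne_zero.2 hq)
      · refine ((isBigO_sub_eval_dilate hT (μ q)).sub (hT.const_mul_left (μ q j))).congr_left
          fun z => ?_
        simp only [map_sub, map_mul, eval_C]
        ring

end Conjugacy

/-! ### The majorant estimate -/

section WeightedNorm

variable {σ : Type*}

/-- The norm `∑_Q |g_Q| v_Q` of a polynomial `g`. -/
def weightedNorm (v : (σ →₀ ℕ) → ℝ) (g : MvPolynomial σ ℂ) : ℝ :=
  ∑ Q ∈ g.support, ‖coeff Q g‖ * v Q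

variable {v v' : (σ →₀ ℕ) → ℝ}

theorem sum_le_weightedNorm (hv : ∀ Q, 0 ≤ v Q) (g : MvPolynomial σ ℂ) (s : Finset (σ →₀ ℕ)) :
    ∑ Q ∈ s, ‖coeff Q g‖ * v Q ≤ weightedNorm v g := by
  classical
  rw [← Finset.sum_filter_of_ne (p := (· ∈ g.support))]
  · exact Finset.sum_le_sum_of_subset_of_nonneg (fun Q hQ => (Finset.mem_filter.1 hQ).2)
      fun Q _ _ => mul_nonneg (norm_nonneg _) (hv Q)
  · intro Q _ h
    rw [mem_support_iff]
    rintro h0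
    simp [h0] at h

theorem weightedNorm_nonneg (hv : ∀ Q, 0 ≤ v Q) (g : MvPolynomial σ ℂ) : 0 ≤ weightedNorm v g :=
  Finset.sum_nonneg fun Q _ => mul_nonneg (norm_nonneg _) (hv Q)

theorem weightedNorm_add_le (hv : ∀ Q, 0 ≤ v Q) (g h : MvPolynomial σ ℂ) :
    weightedNorm v (g + h) ≤ weightedNorm v g + weightedNorm v h := by
  refine le_trans ?_ (add_le_add (sum_le_weightedNorm hv g (g + h).support)
    (sum_le_weightedNorm hv h (g + h).support))
  rw [← Finset.sum_add_distrib]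
  refine Finset.sum_le_sum fun Q _ => ?_
  rw [← add_mul, coeff_add]
  exact mul_le_mul_of_nonneg_right (norm_add_le _ _) (hv Q)

theorem weightedNorm_sum_le (hv : ∀ Q, 0 ≤ v Q) {κ : Type*} (s : Finset κ)
    (g : κ → MvPolynomial σ ℂ) :
    weightedNorm v (∑ i ∈ s, g i) ≤ ∑ i ∈ s, weightedNorm v (g i) :=
  Finset.le_sum_of_subadditive (weightedNorm v) (by simp [weightedNorm])
    (weightedNorm_add_le hv) s g

theorem weightedNorm_monomial_le (v : (σ →₀ ℕ) → ℝ) (Q : σ →₀ ℕ) (x : ℂ) :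
    weightedNorm v (monomial Q x) ≤ ‖x‖ * v Q := by
  classical
  by_cases hx : x = 0
  · simp [hx, weightedNorm]
  · simp [weightedNorm, support_monomial, hx]

theorem weightedNorm_mul_le (hv' : ∀ Q, 0 ≤ v' Q) (g h : MvPolynomial σ ℂ)
    (hmul : ∀ P ∈ g.support, ∀ Q ∈ h.support, v' (P + Q) ≤ v P * v Q) :
    weightedNorm v' (g * h) ≤ weightedNorm v g * weightedNorm v h := by
  have e : g * h = ∑ P ∈ g.support, ∑ Q ∈ h.support,
      monomial (P + Q) (coeff P g * coeff Q h) := by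
    conv_lhs => rw [g.as_sum, h.as_sum, Finset.sum_mul_sum]
    simp only [monomial_mul]
  rw [e, weightedNorm.eq_def v g, weightedNorm.eq_def v h, Finset.sum_mul_sum]
  refine (weightedNorm_sum_le hv' _ _).trans (Finset.sum_le_sum fun P hP => ?_)
  refine (weightedNorm_sum_le hv' _ _).trans (Finset.sum_le_sum fun Q hQ => ?_)
  refine (weightedNorm_monomial_le v' _ _).trans ?_
  rw [norm_mul, mul_mul_mul_comm]
  exact mul_le_mul_of_nonneg_left (hmul P hP Q hQ) (by positivity)

theorem weightedNorm_prod_le (hv : ∀ Q, 0 ≤ v Q) (hv0 : v 0 ≤ 1)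
    (hmul : ∀ P Q, v (P + Q) ≤ v P * v Q) {κ : Type*} (s : Finset κ) (g : κ → MvPolynomial σ ℂ) :
    weightedNorm v (∏ i ∈ s, g i) ≤ ∏ i ∈ s, weightedNorm v (g i) := by
  classical
  induction s using Finset.induction_on with
  | empty =>
    simpa using (weightedNorm_monomial_le v 0 1).trans (by simpa using hv0)
  | insert i s hi ih =>
    rw [Finset.prod_insert hi, Finset.prod_insert hi]
    exact (weightedNorm_mul_le hv _ _ fun P _ Q _ => hmul P Q).trans
      (mul_le_mul_of_nonneg_left ih (weightedNorm_nonneg hv _))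

end WeightedNorm

/-- The majorant estimate: the coefficients produced by the recursion `hrec` grow at most geometrically.
In the norm with weights `r^|Q| / W Q`, dividing a product of at least two factors without constant
term by the small divisors does not increase the product of the norms of the factors (`hv'mul`), and
therefore `Ψ d - X` stays in the ball of radius `r` for `r` small. -/
theorem exists_coeff_bound {ι : Type*} [Fintype ι] {S : UpperSet (Fin n →₀ ℕ)}
    {μ : ι → Fin n → ℂ} {c : ι → Fin n → ∀ k : ℕ, (Fin (k + 2) → Fin n) → ℂ} {M A : ℝ}
    (hM : 0 ≤ M) (hA : 0 ≤ A) (hc : ∀ q j k w, ‖c q j k w‖ ≤ M * A ^ k)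
    {δ : Fin n → (Fin n →₀ ℕ) → ℝ}
    (hδ : ∀ Q ∉ S, 2 ≤ Q.degree → ∀ j, 0 < δ j Q ∧ ∃ q, δ j Q ≤ ‖monomialFun Q (μ q) - μ q j‖)
    {W : (Fin n →₀ ℕ) → ℝ} (hW1 : ∀ Q, 1 ≤ W Q) (hWe : ∀ Q, Q.degree ≤ 1 → W Q = 1)
    {B : ℝ} (hB : 1 ≤ B) (hWB : ∀ Q, W Q ≤ B ^ Q.degree)
    (hWmul : ∀ P Q, W P * W Q ≤ W (P + Q))
    (hWδ : ∀ P Q, P ≠ 0 → Q ≠ 0 → P + Q ∉ S → ∀ j, W P * W Q ≤ δ j (P + Q) * W (P + Q))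
    {Ψ : ℕ → Fin n → MvPolynomial (Fin n) ℂ} (hΨ0 : Ψ 0 = X)
    (hsupp : ∀ d j Q, coeff Q (Ψ d j - X j) ≠ 0 → Q ∉ S ∧ 2 ≤ Q.degree ∧ Q.degree ≤ d + 1)
    (hrec : ∀ d q j, ∀ Q ∉ S, Q.degree ≤ d + 2 →
        (monomialFun Q (μ q) - μ q j) * coeff Q (Ψ (d + 1) j) =
          coeff Q (bind₁ (Ψ d) (tailPoly (c q j) (d + 1)))) :
    ∃ M' A' : ℝ, 0 ≤ M' ∧ 0 ≤ A' ∧ ∀ d j Q, ‖coeff Q (Ψ d j)‖ ≤ M' * A' ^ Q.degree := by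
  classical
  set m : ℝ := (Fintype.card ι : ℝ) with hm_def
  set r : ℝ := 1 / (4 * n * A + 8 * m * M * n ^ 2 + 1) with hr_def
  have hm : 0 ≤ m := Nat.cast_nonneg _
  have hden : 0 < 4 * n * A + 8 * m * M * n ^ 2 + 1 := by positivity
  have hr : 0 < r := by positivity
  have hr1 : r * (4 * n * A + 8 * m * M * n ^ 2 + 1) = 1 := by
    rw [hr_def, one_div, inv_mul_cancel₀ hden.ne']
  have hrA : n * A * (2 * r) ≤ 1 / 2 := by
    have : 0 ≤ r * (8 * m * M * n ^ 2 + 1) := by positivity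
    linarith
  have hrM : m * (M * n ^ 2 * (2 * r) ^ 2 * 2) ≤ r := by
    have h1 : 0 ≤ r * (4 * n * A + 1) := by positivity
    have h2 : r * (8 * m * M * n ^ 2) ≤ 1 := by linarith
    calc m * (M * n ^ 2 * (2 * r) ^ 2 * 2) = r * (r * (8 * m * M * n ^ 2)) := by ring
      _ ≤ r * 1 := mul_le_mul_of_nonneg_left h2 hr.le
      _ = r := mul_one r
  have hWpos (Q) : 0 < W Q := one_pos.trans_le (hW1 Q)
  let v : (Fin n →₀ ℕ) → ℝ := fun Q => r ^ Q.degree / W Q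
  have hv (Q) : 0 < v Q := div_pos (pow_pos hr _) (hWpos Q)
  have hvmul (P Q) : v (P + Q) ≤ v P * v Q := by
    simp only [v]
    rw [div_mul_div_comm, ← pow_add, map_add]
    exact div_le_div_of_nonneg_left (by positivity) (mul_pos (hWpos _) (hWpos _)) (hWmul P Q)
  have hv0 : v 0 ≤ 1 := by simp [v, hWe 0]
  -- the weights of the norm of a series after division by the small divisors
  let v' (j : Fin n) : (Fin n →₀ ℕ) → ℝ := fun Q =>
    if Q ∉ S ∧ 2 ≤ Q.degree then v Q / δ j Q else 0
  have hv' (j Q) : 0 ≤ v' j Q := by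
    simp only [v']
    split_ifs with h
    · exact div_nonneg (hv Q).le (hδ Q h.1 h.2 j).1.le
    · exact le_rfl
  have hv'mul (j P Q) (hP : P ≠ 0) (hQ : Q ≠ 0) : v' j (P + Q) ≤ v P * v Q := by
    simp only [v']
    split_ifs with h
    · simp only [v]
      rw [div_mul_div_comm, ← pow_add, map_add, div_div]
      refine div_le_div_of_nonneg_left (by positivity) (mul_pos (hWpos _) (hWpos _)) ?_
      rw [mul_comm (W (P + Q))]
      exact hWδ P Q hP hQ h.1 j
    · exact mul_nonneg (hv P).le (hv Q).le
  have hX (a) : weightedNorm v (X a) ≤ r := by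
    refine (weightedNorm_monomial_le v _ _).trans ?_
    simp [v, hWe (Finsupp.single a 1)]
  have hconst (d a) : constantCoeff (Ψ d a) = 0 := by
    have h : coeff 0 (Ψ d a - X a) = 0 := by
      by_contra h
      have := (hsupp d a 0 h).2.1
      simp at this
    rw [coeff_sub] at h
    simpa [constantCoeff_eq] using h
  have htwo (d) (h : ∀ j, weightedNorm v (Ψ d j - X j) ≤ r) (a) : weightedNorm v (Ψ d a) ≤ 2 * r := by
    have := weightedNorm_add_le (fun Q => (hv Q).le) (Ψ d a - X a) (X a)
    rw [sub_add_cancel] at this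
    linarith [h a, hX a]
  -- the nonlinearity maps the ball of radius `2 r` to small series, even after division
  have hstep (d) (h : ∀ j, weightedNorm v (Ψ d j - X j) ≤ r) (q j) :
      weightedNorm (v' j) (bind₁ (Ψ d) (tailPoly (c q j) (d + 1))) ≤
        M * n ^ 2 * (2 * r) ^ 2 * 2 := by
    have hword (k : ℕ) (w : Fin (k + 2) → Fin n) :
        weightedNorm (v' j) (C (c q j k w) * ∏ i, Ψ d (w i)) ≤ M * A ^ k * (2 * r) ^ (k + 2) := by
      have e : C (c q j k w) * ∏ i, Ψ d (w i) =
          (C (c q j k w) * Ψ d (w 0)) * ∏ i : Fin (k + 1), Ψ d (w i.succ) := by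
        rw [Fin.prod_univ_succ, mul_assoc]
      have hne {g : MvPolynomial (Fin n) ℂ} (hg : constantCoeff g = 0) : ∀ P ∈ g.support, P ≠ 0 := by
        rintro P hP rfl
        exact (mem_support_iff.1 hP) hg
      have h1 := weightedNorm_mul_le (v := v) (hv' j) (C (c q j k w) * Ψ d (w 0))
        (∏ i : Fin (k + 1), Ψ d (w i.succ)) fun P hP Q hQ => hv'mul j P Q
          (hne (by rw [map_mul, hconst, mul_zero]) P hP)
          (hne (by rw [map_prod, Fin.prod_univ_succ, hconst, zero_mul]) Q hQ)
      have h2 : weightedNorm v (C (c q j k w) * Ψ d (w 0)) ≤ M * A ^ k * (2 * r) := by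
        refine (weightedNorm_mul_le (v := v) (fun Q => (hv Q).le) _ _
          fun P _ Q _ => hvmul P Q).trans ?_
        refine mul_le_mul ?_ (htwo d h _) (weightedNorm_nonneg (fun Q => (hv Q).le) _)
          (by positivity)
        refine (weightedNorm_monomial_le v 0 _).trans ?_
        exact (mul_le_of_le_one_right (norm_nonneg _) hv0).trans (hc q j k w)
      have h3 : weightedNorm v (∏ i : Fin (k + 1), Ψ d (w i.succ)) ≤ (2 * r) ^ (k + 1) := by
        refine (weightedNorm_prod_le (fun Q => (hv Q).le) hv0 hvmul _ _).trans ?_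
        refine (Finset.prod_le_prod (fun i _ => weightedNorm_nonneg (fun Q => (hv Q).le) _)
          fun i _ => htwo d h _).trans ?_
        simp
      rw [e]
      calc _ ≤ _ := h1
        _ ≤ M * A ^ k * (2 * r) * (2 * r) ^ (k + 1) :=
            mul_le_mul h2 h3 (weightedNorm_nonneg (fun Q => (hv Q).le) _) (by positivity)
        _ = _ := by ring
    have e : bind₁ (Ψ d) (tailPoly (c q j) (d + 1)) = ∑ k ∈ Finset.range (d + 1),
        ∑ w : Fin (k + 2) → Fin n, C (c q j k w) * ∏ i, Ψ d (w i) := by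
      simp [tailPoly, map_sum, map_prod]
    rw [e]
    calc _ ≤ ∑ k ∈ Finset.range (d + 1), ∑ w : Fin (k + 2) → Fin n, M * A ^ k * (2 * r) ^ (k + 2) :=
          (weightedNorm_sum_le (hv' j) _ _).trans (Finset.sum_le_sum fun k _ =>
            (weightedNorm_sum_le (hv' j) _ _).trans (Finset.sum_le_sum fun w _ => hword k w))
      _ = M * n ^ 2 * (2 * r) ^ 2 * ∑ k ∈ Finset.range (d + 1), (n * A * (2 * r)) ^ k := by
          rw [Finset.mul_sum]
          refine Finset.sum_congr rfl fun k _ => ?_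
          simp
          ring
      _ ≤ M * n ^ 2 * (2 * r) ^ 2 * 2 := by
          gcongr
          calc ∑ k ∈ Finset.range (d + 1), (n * A * (2 * r)) ^ k
              ≤ ∑ k ∈ Finset.range (d + 1), (1 / 2 : ℝ) ^ k :=
                Finset.sum_le_sum fun k _ => pow_le_pow_left₀ (by positivity) hrA k
            _ ≤ 2 := sum_geometric_two_le _
  have hmain (d) : ∀ j, weightedNorm v (Ψ d j - X j) ≤ r := by
    induction d with
    | zero => intro j; simpa [hΨ0, weightedNorm] using hr.le
    | succ d ih =>
      intro j
      calc weightedNorm v (Ψ (d + 1) j - X j)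
          ≤ ∑ Q ∈ (Ψ (d + 1) j - X j).support, ∑ q,
              ‖coeff Q (bind₁ (Ψ d) (tailPoly (c q j) (d + 1)))‖ * v' j Q := by
            refine Finset.sum_le_sum fun Q hQ => ?_
            obtain ⟨h1, h2, h3⟩ := hsupp (d + 1) j Q (mem_support_iff.1 hQ)
            obtain ⟨hpos, q, hq⟩ := hδ Q h1 h2 j
            have hXQ : coeff Q (X j : MvPolynomial (Fin n) ℂ) = 0 := by
              rw [coeff_X, if_neg]
              rintro rfl
              simp at h2
            have h4 : ‖coeff Q (Ψ (d + 1) j)‖ * v Q ≤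
                ‖coeff Q (bind₁ (Ψ d) (tailPoly (c q j) (d + 1)))‖ * v' j Q := by
              rw [← hrec d q j Q h1 h3, norm_mul]
              simp only [v', if_pos (And.intro h1 h2)]
              rw [← mul_div_assoc _ (v Q) (δ j Q), le_div_iff₀ hpos]
              calc ‖coeff Q (Ψ (d + 1) j)‖ * v Q * δ j Q
                  ≤ ‖coeff Q (Ψ (d + 1) j)‖ * v Q * ‖monomialFun Q (μ q) - μ q j‖ :=
                    mul_le_mul_of_nonneg_left hq (mul_nonneg (norm_nonneg _) (hv Q).le)
                _ = _ := by ring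
            rw [coeff_sub, hXQ, sub_zero]
            exact h4.trans (Finset.single_le_sum
              (f := fun q => ‖coeff Q (bind₁ (Ψ d) (tailPoly (c q j) (d + 1)))‖ * v' j Q)
              (fun q _ => mul_nonneg (norm_nonneg _) (hv' j Q)) (Finset.mem_univ q))
        _ ≤ ∑ q : ι, M * n ^ 2 * (2 * r) ^ 2 * 2 := by
            rw [Finset.sum_comm]
            exact Finset.sum_le_sum fun q _ =>
              (sum_le_weightedNorm (hv' j) _ _).trans (hstep d ih q j)
        _ = m * (M * n ^ 2 * (2 * r) ^ 2 * 2) := by simp [hm_def]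
        _ ≤ r := hrM
  refine ⟨2 * r, B / r, by positivity, by positivity, fun d j Q => ?_⟩
  have h1 := (sum_le_weightedNorm (fun Q => (hv Q).le) (Ψ d j) {Q}).trans (htwo d (hmain d) j)
  rw [Finset.sum_singleton, ← le_div_iff₀ (hv Q)] at h1
  calc _ ≤ 2 * r / v Q := h1
    _ = 2 * r * (W Q / r ^ Q.degree) := by simp only [v]; rw [div_div_eq_mul_div, mul_div_assoc]
    _ ≤ 2 * r * (B ^ Q.degree / r ^ Q.degree) := by gcongr; exact hWB Q
    _ = _ := by rw [div_pow B r]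

/-- The formal conjugacy converges. -/
theorem exists_analytic_conjugacy {ι : Type*} [Fintype ι] {S : UpperSet (Fin n →₀ ℕ)}
    {F : ι → (Fin n → ℂ) → Fin n → ℂ} {μ : ι → Fin n → ℂ}
    {c : ι → Fin n → ∀ k : ℕ, (Fin (k + 2) → Fin n) → ℂ} {M A : ℝ}
    (hM : 0 ≤ M) (hA : 0 ≤ A) (hc : ∀ q j k w, ‖c q j k w‖ ≤ M * A ^ k)
    (hF : ∀ q j, HasTail (fun z => F q z j) (Pi.single j (μ q j)) (c q j))
    (hcomm : ∀ q r, ∀ᶠ z in 𝓝 (0 : Fin n → ℂ), F q (F r z) = F r (F q z))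
    {δ : Fin n → (Fin n →₀ ℕ) → ℝ}
    (hδ : ∀ Q ∉ S, 2 ≤ Q.degree → ∀ j, 0 < δ j Q ∧ ∃ q, δ j Q ≤ ‖monomialFun Q (μ q) - μ q j‖)
    {W : (Fin n →₀ ℕ) → ℝ} (hW1 : ∀ Q, 1 ≤ W Q) (hWe : ∀ Q, Q.degree ≤ 1 → W Q = 1)
    {B : ℝ} (hB : 1 ≤ B) (hWB : ∀ Q, W Q ≤ B ^ Q.degree)
    (hWmul : ∀ P Q, W P * W Q ≤ W (P + Q))
    (hWδ : ∀ P Q, P ≠ 0 → Q ≠ 0 → P + Q ∉ S → ∀ j, W P * W Q ≤ δ j (P + Q) * W (P + Q)) :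
    ∃ Ψ : (Fin n → ℂ) → Fin n → ℂ, AnalyticAt ℂ Ψ 0 ∧ IsJet Ψ ∧
      (∀ j, (fun z => Ψ z j - z j) =O[𝓝 0] fun z => ‖z‖ ^ 2) ∧
      ∀ d q j, MemUpTo S d (defect (F q) (μ q) Ψ j) := by
  have hS : ∀ Q ∉ S, 2 ≤ Q.degree → ∀ j, ∃ q, monomialFun Q (μ q) ≠ μ q j := by
    intro Q hQ hQ2 j
    obtain ⟨hpos, q, hq⟩ := hδ Q hQ hQ2 j
    exact ⟨q, sub_ne_zero.1 (norm_pos_iff.1 (hpos.trans_le hq))⟩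
  obtain ⟨Φ, hΦ0, hst, hstab, hrec⟩ := exists_formal_conjugacy hF hcomm hS
  obtain ⟨M', A', hM', hA', hbound⟩ := exists_coeff_bound hM hA hc hδ hW1 hWe hB hWB hWmul hWδ hΦ0
    (fun d => (hst d).coeff_ne_zero) hrec
  have hcoef (d j Q) (h : Q.degree < d + 2) : coeff Q (Φ d j) = coeff Q (Φ Q.degree j) := by
    induction d with
    | zero =>
      have : Q.degree = 0 ∨ Q.degree = 1 := by omega
      rcases this with h | h
      · rw [h]
      · rw [h, hstab 0 j Q (by omega)]
    | succ d ih =>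
      rcases (Nat.lt_succ_iff.1 h).lt_or_eq with h1 | h1
      · rw [hstab d j Q (by omega), ih h1]
      · rw [h1, hstab (d + 1) j Q (by omega)]
  have hf (j) := exists_analyticAt_of_coeff (fun Q => coeff Q (Φ Q.degree j)) M' A' hM' hA'
    (fun Q => hbound _ j Q)
  choose f hfa hfT using hf
  have hfΦ (d j) : (fun z => f j z - eval z (Φ d j)) =O[𝓝 0] fun z => ‖z‖ ^ (d + 2) :=
    hfT j (d + 2) _ fun Q hQ => hcoef d j Q hQ
  have hjet : IsJet fun z a => f a z := by
    refine ⟨fun a d => ⟨Φ d a, isBigO_pow_mono (hfΦ d a) (by omega)⟩, fun a => ?_⟩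
    have := (isBigO_pow_mono (hfΦ 0 a) one_le_two).add ((hst 0).isJet.isBigO a)
    simpa using this
  refine ⟨fun z a => f a z, analyticAt_pi_iff.2 hfa, hjet, fun j => ?_, fun d q j => ?_⟩
  · simpa [hΦ0] using hfΦ 0 j
  · have hsub (a) : HasTaylor fun z => f a z - eval z (Φ d a) :=
      (hjet.hasTaylor a).sub (HasTaylor.eval _)
    have h1 := (hF q j).memUpTo_sub (S := S) (d := d + 2) (u := fun a z => eval z (Φ d a))
      (v := fun a z => f a z - eval z (Φ d a)) (hst d).isJet.hasTaylor hsub (hst d).isJet.isBigO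
      (fun a => isBigO_pow_mono (hfΦ d a) (by omega)) fun a => MemUpTo.of_isBigO (hfΦ d a)
    have h2 : MemUpTo S (d + 2) fun z => (f j (μ q * z) - eval (μ q * z) (Φ d j)) :=
      MemUpTo.of_isBigO (isBigO_comp (hfΦ d j) (isBigO_dilation (μ q)))
    have h3 : MemUpTo S (d + 2) fun z => μ q j * (f j z - eval z (Φ d j)) :=
      (MemUpTo.of_isBigO (hfΦ d j)).const_mul _
    refine (((((h1.mono (Nat.le_succ _)).add ((hst d).memUpTo q j)).add h3).sub h2).congr
      (Eventually.of_forall fun z => ?_)).mono (by omega : d ≤ d + 2)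
    have e : (fun a => eval z (Φ d a) + (f a z - eval z (Φ d a))) = fun a => f a z := by
      funext a; ring
    simp only [e, sum_single_mul, defect]
    ring

/-! ### Monomials of the ideal, resonances and weights -/

/-- The exponents `Q` such that `x^Q` is divisible by one of the monomials `x^{R_k}`. -/
def multiples {p : ℕ} (R : Fin p → (Fin n →₀ ℕ)) : UpperSet (Fin n →₀ ℕ) where
  carrier := {Q | ∃ k, R k ≤ Q}
  upper' := fun _ _ hPQ ⟨k, hk⟩ => ⟨k, hk.trans hPQ⟩

theorem eval_monomial_eq (Q : Fin n →₀ ℕ) (c : ℂ) (z : Fin n → ℂ) :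
    eval z (monomial Q c) = c * monomialFun Q z := by
  rw [eval_monomial, Finsupp.prod_fintype _ _ (by simp), monomialFun]

theorem monomialFun_add (P Q : Fin n →₀ ℕ) (z : Fin n → ℂ) :
    monomialFun (P + Q) z = monomialFun P z * monomialFun Q z := by
  simp [monomialFun, pow_add, Finset.prod_mul_distrib]

theorem monomialFun_mul (Q : Fin n →₀ ℕ) (y z : Fin n → ℂ) :
    monomialFun Q (y * z) = monomialFun Q y * monomialFun Q z := by
  simp [monomialFun, mul_pow, Finset.prod_mul_distrib]

theorem monomialFun_single (a : Fin n) (z : Fin n → ℂ) :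
    monomialFun (Finsupp.single a 1) z = z a := by
  rw [monomialFun, Finset.prod_eq_single a]
  · simp
  · intro b _ hb; simp [hb.symm]
  · simp

theorem hasTaylor_of_analyticAt {f : (Fin n → ℂ) → ℂ} (hf : AnalyticAt ℂ f 0) : HasTaylor f := by
  obtain ⟨c, -, -, -, -, -, hc⟩ := exists_hasTail (f := fun z => f z - f 0)
    (hf.sub analyticAt_const) (sub_self _) (hf.differentiableAt.sub_const _).hasFDerivAt
  simpa using hc.hasTaylor.add (HasTaylor.const (f 0))

theorem memUpTo_of_mem_monomialIdeal {p : ℕ} {R : Fin p → (Fin n →₀ ℕ)} {g : HolGerm n}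
    (hg : g ∈ monomialIdeal R) {f : (Fin n → ℂ) → ℂ}
    (hfg : (f : Germ (𝓝 (0 : Fin n → ℂ)) ℂ) = g.1) (d : ℕ) : MemUpTo (multiples R) d f := by
  induction hg using Submodule.span_induction generalizing f with
  | mem x hx =>
    obtain ⟨k, rfl⟩ := hx
    refine MemUpTo.congr ⟨monomial (R k) 1, mem_monoIdeal.2 fun Q hQ => ?_, ?_⟩
      (Germ.coe_eq.1 hfg).symm
    · rw [coeff_monomial, if_neg]
      rintro rfl
      exact hQ ⟨k, le_rfl⟩
    · simpa [eval_monomial_eq] using isBigO_zero _ _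
  | zero =>
    have h0 : (f : Germ (𝓝 (0 : Fin n → ℂ)) ℂ) = ((0 : (Fin n → ℂ) → ℂ) : Germ _ ℂ) := hfg
    exact MemUpTo.zero.congr (Germ.coe_eq.1 h0).symm
  | add x y _ _ hx hy =>
    obtain ⟨u, hu, hux⟩ := x.2
    obtain ⟨v, hv, hvy⟩ := y.2
    refine ((hx hux).add (hy hvy)).congr (Germ.coe_eq.1 (Eq.symm (hfg.trans ?_)))
    change x.1 + y.1 = _
    rw [← hux, ← hvy]
    rfl
  | smul a x _ hx =>
    obtain ⟨u, hu, hux⟩ := x.2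
    obtain ⟨v, hv, hva⟩ := a.2
    have hvt := hasTaylor_of_analyticAt hv
    have h1 := (hx hux).mul hvt hvt.isBigO_one
    refine MemUpTo.congr (by simpa using h1) (Germ.coe_eq.1 (Eq.symm (hfg.trans ?_)))
    change a.1 * x.1 = _
    rw [← hux, ← hva, mul_comm]
    rfl

theorem mem_multiples_of_monomialGerm_mem {p : ℕ} {R : Fin p → (Fin n →₀ ℕ)} {Q : Fin n →₀ ℕ}
    (h : monomialGerm Q ∈ monomialIdeal R) : Q ∈ multiples R := by
  by_contra hQ
  have h1 := memUpTo_of_mem_monomialIdeal h (f := monomialFun Q) rfl (Q.degree + 1)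
  have h2 := (memUpTo_iff (T := monomial Q 1) (by simpa [eval_monomial_eq] using isBigO_zero _ _)).1
    h1 Q hQ (Nat.lt_succ_self _)
  simp at h2

theorem isZeroLocus_monomialIdeal {p : ℕ} (R : Fin p → (Fin n →₀ ℕ)) :
    IsZeroLocus (monomialIdeal R) {z | ∀ k, monomialFun (R k) z = 0} := by
  constructor
  · suffices h : ∀ g ∈ monomialIdeal R, ∀ f : (Fin n → ℂ) → ℂ,
        (f : Germ (𝓝 (0 : Fin n → ℂ)) ℂ) = g.1 →
        ∀ᶠ z in 𝓝 (0 : Fin n → ℂ), (∀ k, monomialFun (R k) z = 0) → f z = 0 from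
      fun f hf hfJ => h _ hfJ f rfl
    intro g hg
    induction hg using Submodule.span_induction with
    | mem x hx =>
      obtain ⟨k, rfl⟩ := hx
      intro f hf
      filter_upwards [Germ.coe_eq.1 hf] with z hz hV
      rw [hz, hV k]
    | zero =>
      intro f hf
      have h0 : (f : Germ (𝓝 (0 : Fin n → ℂ)) ℂ) = ((0 : (Fin n → ℂ) → ℂ) : Germ _ ℂ) := hf
      filter_upwards [Germ.coe_eq.1 h0] with z hz _ using hz
    | add x y _ _ hx hy =>
      intro f hf
      obtain ⟨u, hu, hux⟩ := x.2
      obtain ⟨v, hv, hvy⟩ := y.2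
      have : (f : Germ (𝓝 (0 : Fin n → ℂ)) ℂ) = ((u + v : (Fin n → ℂ) → ℂ) : Germ _ ℂ) := by
        rw [hf, Germ.coe_add, hux, hvy]; rfl
      filter_upwards [hx u hux, hy v hvy, Germ.coe_eq.1 this] with z h1 h2 h3 hV
      rw [h3, Pi.add_apply, h1 hV, h2 hV, add_zero]
    | smul a x _ hx =>
      intro f hf
      obtain ⟨u, hu, hux⟩ := x.2
      obtain ⟨v, hv, hva⟩ := a.2
      have : (f : Germ (𝓝 (0 : Fin n → ℂ)) ℂ) = ((v * u : (Fin n → ℂ) → ℂ) : Germ _ ℂ) := by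
        rw [hf, Germ.coe_mul, hux, hva]; rfl
      filter_upwards [hx u hux, Germ.coe_eq.1 this] with z h1 h3 hV
      rw [h3, Pi.mul_apply, h1 hV, mul_zero]
  · exact ⟨p, fun k => monomialFun (R k), fun k => analyticAt_monomialFun _ _,
      fun k => Ideal.subset_span ⟨k, rfl⟩, Eventually.of_forall fun z hz => hz⟩

theorem rescale_monomial (ν : Fin n → ℂ) (Q : Fin n →₀ ℕ) (c : ℂ) :
    MvPowerSeries.rescale ν (MvPowerSeries.monomial Q c) =
      MvPowerSeries.monomial Q (monomialFun Q ν * c) := by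
  classical
  ext P
  rw [MvPowerSeries.coeff_rescale, MvPowerSeries.coeff_monomial, MvPowerSeries.coeff_monomial]
  split_ifs with h
  · subst h
    rw [Finsupp.prod_fintype _ _ (by simp), monomialFun]
  · simp

theorem exists_ne_of_centralizerGeneratedBy {p : ℕ} {ι : Type*} {μ : ι → Fin n → ℂ}
    {R : Fin p → (Fin n →₀ ℕ)} (hcent : CentralizerGeneratedBy μ R) {Q : Fin n →₀ ℕ}
    (hQ : Q ∉ multiples R) (hQ2 : 2 ≤ Q.degree) (j : Fin n) :
    ∃ q, monomialFun Q (μ q) ≠ μ q j := by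
  classical
  by_contra! h
  have h1 := hcent (Pi.single j (MvPowerSeries.monomial Q 1)) ⟨fun i P hP => ?_, fun q i => ?_⟩ j
  · rw [Pi.single_eq_same] at h1
    have key : ∀ f ∈ Ideal.span (Set.range fun k => MvPowerSeries.monomial (R k) (1 : ℂ)),
        ∀ P ∉ multiples R, MvPowerSeries.coeff P f = 0 := by
      intro f hf
      induction hf using Submodule.span_induction with
      | mem x hx =>
        obtain ⟨k, rfl⟩ := hx
        intro P hP
        rw [MvPowerSeries.coeff_monomial, if_neg]
        rintro rfl
        exact hP ⟨k, le_rfl⟩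
      | zero => intro P _; simp
      | add x y _ _ hx hy => intro P hP; rw [map_add, hx P hP, hy P hP, add_zero]
      | smul a x _ hx =>
        intro P hP
        rw [smul_eq_mul, MvPowerSeries.coeff_mul]
        refine Finset.sum_eq_zero fun PQ hPQ => ?_
        rw [hx PQ.2, mul_zero]
        intro hmem
        refine hP ((multiples R).upper ?_ hmem)
        rw [← Finset.HasAntidiagonal.mem_antidiagonal.1 hPQ]
        exact le_add_self
    have := key _ h1 Q hQ
    simp at this
  · rcases eq_or_ne i j with rfl | hij
    · rw [Pi.single_eq_same, MvPowerSeries.coeff_monomial, if_neg]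
      rintro rfl
      omega
    · rw [Pi.single_eq_of_ne hij, map_zero]
  · rcases eq_or_ne i j with rfl | hij
    · rw [Pi.single_eq_same, rescale_monomial, h q]
      ext P
      simp [MvPowerSeries.coeff_monomial]
    · rw [Pi.single_eq_of_ne hij, map_zero, smul_zero]

theorem monomialFun_eq_one_of_invariantsGeneratedBy {p : ℕ} {ι : Type*} {μ : ι → Fin n → ℂ}
    {R : Fin p → (Fin n →₀ ℕ)} (hR : ∀ k, R k ≠ 0) (hinv : InvariantsGeneratedBy μ R)
    (k : Fin p) (q : ι) : monomialFun (R k) (μ q) = 1 := by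
  classical
  have hsub : MvPowerSeries.HasSubst fun k => MvPowerSeries.monomial (R k) (1 : ℂ) :=
    MvPowerSeries.hasSubst_of_constantCoeff_zero fun k => by
      rw [← MvPowerSeries.coeff_zero_eq_constantCoeff_apply, MvPowerSeries.coeff_monomial,
        if_neg (hR k).symm]
  have h1 : MvPowerSeries.monomial (R k) (1 : ℂ) ∈ formalInvariants μ := by
    rw [← SetLike.mem_coe, hinv]
    exact ⟨MvPowerSeries.X k, MvPowerSeries.subst_X hsub k⟩
  have h2 := congrArg (MvPowerSeries.coeff (R k)) (h1 q)
  rw [rescale_monomial] at h2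
  simpa using h2

theorem mem_multiples_of_invariantsGeneratedBy {p : ℕ} {ι : Type*} {μ : ι → Fin n → ℂ}
    {R : Fin p → (Fin n →₀ ℕ)} (hR : ∀ k, R k ≠ 0) (hinv : InvariantsGeneratedBy μ R)
    {Q : Fin n →₀ ℕ} (hQ : Q ≠ 0) (hQμ : ∀ q, monomialFun Q (μ q) = 1) : Q ∈ multiples R := by
  classical
  have hsub : MvPowerSeries.HasSubst fun k => MvPowerSeries.monomial (R k) (1 : ℂ) :=
    MvPowerSeries.hasSubst_of_constantCoeff_zero fun k => by
      rw [← MvPowerSeries.coeff_zero_eq_constantCoeff_apply, MvPowerSeries.coeff_monomial,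
        if_neg (hR k).symm]
  have h1 : MvPowerSeries.monomial Q (1 : ℂ) ∈ (formalInvariants μ : Set _) := fun q => by
    rw [rescale_monomial, hQμ q, one_mul]
  rw [hinv] at h1
  obtain ⟨g, hg⟩ := h1
  have h2 := congrArg (MvPowerSeries.coeff Q) hg
  simp only [MvPowerSeries.coeff_subst hsub] at h2
  rw [MvPowerSeries.coeff_monomial_same] at h2
  by_contra hQS
  refine one_ne_zero (h2.symm.trans (finsum_eq_zero_of_forall_eq_zero fun K => ?_))
  have h3 : (K.prod fun k e => (MvPowerSeries.monomial (R k) (1 : ℂ)) ^ e) =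
      MvPowerSeries.monomial (∑ k, K k • R k) 1 := by
    rw [Finsupp.prod_fintype _ _ (by simp)]
    simp only [MvPowerSeries.monomial_pow, one_pow]
    rw [MvPowerSeries.prod_monomial]
    simp
  rw [h3, MvPowerSeries.coeff_monomial]
  split_ifs with h
  · exfalso
    have : ∃ k, K k ≠ 0 := by
      by_contra! h0
      exact hQ (by rw [h]; simp [h0])
    obtain ⟨k, hk⟩ := this
    refine hQS ⟨k, ?_⟩
    rw [h]
    calc R k ≤ K k • R k := le_smul_of_one_le_left (zero_le) (Nat.one_le_iff_ne_zero.2 hk)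
      _ ≤ _ := Finset.single_le_sum (f := fun k => K k • R k) (fun _ _ => zero_le)
        (Finset.mem_univ k)
  · simp

/-! ### Weights from the diophantine condition -/

section Diophantine

variable {ι : Type*} [Finite ι] {μ : ι → Fin n → ℂ} {J : Ideal (HolGerm n)}

theorem norm_le_smallDivisor (μ : ι → Fin n → ℂ) (Q : Fin n →₀ ℕ) (j : Fin n) (q : ι) :
    ‖monomialFun Q (μ q) - μ q j‖ ≤ smallDivisor μ Q j :=
  le_ciSup (f := fun q => ‖monomialFun Q (μ q) - μ q j‖) (Set.finite_range _).bddAbove q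

theorem smallDivisor_nonneg (μ : ι → Fin n → ℂ) (Q : Fin n →₀ ℕ) (j : Fin n) :
    0 ≤ smallDivisor μ Q j :=
  Real.iSup_nonneg fun _ => norm_nonneg _

theorem exists_smallDivisor_eq {Q : Fin n →₀ ℕ} {j : Fin n} (h : 0 < smallDivisor μ Q j) :
    ∃ q, smallDivisor μ Q j ≤ ‖monomialFun Q (μ q) - μ q j‖ := by
  have : Nonempty ι := by
    by_contra hι
    rw [not_nonempty_iff] at hι
    simp [smallDivisor] at h
  obtain ⟨q, hq⟩ := exists_eq_ciSup_of_finite (f := fun q => ‖monomialFun Q (μ q) - μ q j‖)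
  exact ⟨q, hq.ge⟩

theorem finite_smallDivisorSet (μ : ι → Fin n → ℂ) (J : Ideal (HolGerm n)) (k : ℕ) :
    (smallDivisorSet μ J k).Finite := by
  refine (((Finsupp.finite_of_degree_le (σ := Fin n) (2 ^ k)).prod
    (Set.finite_univ (α := Fin n))).image fun x => smallDivisor μ x.1 x.2).subset ?_
  rintro d ⟨-, Q, j, -, h, -, rfl⟩
  exact ⟨(Q, j), ⟨h, Set.mem_univ _⟩, rfl⟩

theorem exp_neg_le_of_mem_smallDivisorSet {k : ℕ} {d : ℝ} (hd : d ∈ smallDivisorSet μ J k) :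
    Real.exp (-max 0 (negLogOmega μ J k)) ≤ d := by
  have hne : (smallDivisorSet μ J k).Nonempty := ⟨d, hd⟩
  have hle : sInf (smallDivisorSet μ J k) ≤ d :=
    csInf_le (finite_smallDivisorSet μ J k).bddBelow hd
  have hpos : 0 < sInf (smallDivisorSet μ J k) := by
    obtain ⟨h0, Q, j, -, -, -, h⟩ := hne.csInf_mem (finite_smallDivisorSet μ J k)
    exact lt_of_le_of_ne (h ▸ smallDivisor_nonneg μ Q j) h0.symm
  refine le_trans ?_ hle
  rw [negLogOmega, if_pos hne]
  calc Real.exp (-max 0 (-Real.log (sInf (smallDivisorSet μ J k))))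
      ≤ Real.exp (Real.log (sInf (smallDivisorSet μ J k))) :=
        Real.exp_le_exp.2 (neg_le.1 (le_max_right _ _))
    _ = _ := Real.exp_log hpos

/-- The weight for the small divisors of a family that is diophantine on the monomial ideal. If two
exponents `Q < K` outside the ideal have divisors less than a small multiple of `ω_k` for the same
index `j`, then `μ^(K-Q)` is close to `1`. For `i` in the support of `Q`, the exponent `K - Q + e_i`
divides `K`, so it is outside the ideal too, and its divisor for the index `i` is less than
`ω_k`; hence its degree exceeds `2^k`. -/
theorem exists_weight_of_isDiophantineOn {p : ℕ} {R : Fin p → (Fin n →₀ ℕ)}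
    (hμ : ∀ q a, μ q a ≠ 0) (hcent : CentralizerGeneratedBy μ R)
    (hdioph : IsDiophantineOn μ (monomialIdeal R)) :
    ∃ W : (Fin n →₀ ℕ) → ℝ, (∀ Q, 1 ≤ W Q) ∧ (∀ Q, Q.degree ≤ 1 → W Q = 1) ∧
      (∃ C, 1 ≤ C ∧ ∀ Q, W Q ≤ C ^ Q.degree) ∧ (∀ P Q, W P * W Q ≤ W (P + Q)) ∧
      ∀ P Q, P ≠ 0 → Q ≠ 0 → P + Q ∉ multiples R → ∀ j,
        W P * W Q ≤ smallDivisor μ (P + Q) j * W (P + Q) := by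
  have hpos {Q : Fin n →₀ ℕ} (hQ : Q ∉ multiples R) (hQ2 : 2 ≤ Q.degree) (j : Fin n) :
      0 < smallDivisor μ Q j := by
    obtain ⟨q, hq⟩ := exists_ne_of_centralizerGeneratedBy hcent hQ hQ2 j
    exact (norm_pos_iff.2 (sub_ne_zero.2 hq)).trans_le (norm_le_smallDivisor μ Q j q)
  set ω : ℕ → ℝ := fun k => Real.exp (-max 0 (negLogOmega μ (monomialIdeal R) k)) with hω
  have hω0 (k) : 0 < ω k := Real.exp_pos _
  have hω1 (k) : ω k ≤ 1 := Real.exp_le_one_iff.2 (neg_nonpos.2 (le_max_left _ _))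
  have hωle {Q : Fin n →₀ ℕ} (hQ : Q ∉ multiples R) (hQ2 : 2 ≤ Q.degree) (j : Fin n) {k : ℕ}
      (hk : Q.degree ≤ 2 ^ k) : ω k ≤ smallDivisor μ Q j :=
    exp_neg_le_of_mem_smallDivisorSet ⟨(hpos hQ hQ2 j).ne', Q, j, hQ2, hk,
      fun h => hQ (mem_multiples_of_monomialGerm_mem h), rfl⟩
  -- bounds for the eigenvalues
  obtain ⟨a, ha0, ha1, ha⟩ : ∃ a : ℝ, 0 < a ∧ a ≤ 1 ∧ ∀ q j, a ≤ ‖μ q j‖ := by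
    obtain ⟨a, ha⟩ := (Set.finite_range fun x : ι × Fin n => ‖μ x.1 x.2‖⁻¹).bddAbove
    have hm : 0 < max 1 a := zero_lt_one.trans_le (le_max_left _ _)
    refine ⟨(max 1 a)⁻¹, inv_pos.2 hm, inv_le_one_of_one_le₀ (le_max_left _ _), fun q j => ?_⟩
    rw [inv_le_comm₀ hm (norm_pos_iff.2 (hμ q j))]
    exact (ha ⟨(q, j), rfl⟩).trans (le_max_right _ _)
  obtain ⟨b, hb1, hb⟩ : ∃ b : ℝ, 1 ≤ b ∧ ∀ q j, ‖μ q j‖ ≤ b := by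
    obtain ⟨b, hb⟩ := (Set.finite_range fun x : ι × Fin n => ‖μ x.1 x.2‖).bddAbove
    exact ⟨max 1 b, le_max_left _ _, fun q j => (hb ⟨(q, j), rfl⟩).trans (le_max_right _ _)⟩
  set θ : ℝ := a / (8 * b) with hθ
  have hb0 : 0 < b := one_pos.trans_le hb1
  have hθ0 : 0 < θ := by positivity
  have hθb : 8 * (b * θ) = a := by rw [hθ]; field_simp
  have hθa : 8 * θ ≤ a := by
    rw [← hθb]
    have := le_mul_of_one_le_left hθ0.le hb1
    linarith
  have hθ1 : θ ≤ 1 := by linarith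
  have hε1 (k) : θ * ω (k + 1) ≤ ω (k + 1) := mul_le_of_le_one_left (hω0 _).le hθ1
  have hweight := exists_weight (fun j Q => smallDivisor μ Q j)
    {Q | Q ∉ multiples R ∧ 2 ≤ Q.degree} (fun k => θ * ω (k + 1))
    (fun k => mul_pos hθ0 (hω0 _)) (fun k => (hε1 k).trans (hω1 _)) ?_ ?_ ?_
  obtain ⟨W, h1, h2, h3, h4, h5⟩ := hweight
  · refine ⟨W, h1, h2, h3, h4, fun P Q hP hQ hPQ j => h5 P Q hP hQ ⟨hPQ, ?_⟩ j⟩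
    have hP' : P.degree ≠ 0 := by simpa [Finsupp.degree_eq_zero_iff]
    have hQ' : Q.degree ≠ 0 := by simpa [Finsupp.degree_eq_zero_iff]
    rw [map_add]
    omega
  · have e (k : ℕ) : -Real.log (θ * ω (k + 1)) / 2 ^ (k + 1) = -Real.log θ / 2 * (1 / 2) ^ k +
        max 0 (negLogOmega μ (monomialIdeal R) (k + 1)) / 2 ^ (k + 1) := by
      rw [Real.log_mul hθ0.ne' (hω0 _).ne', hω, Real.log_exp, one_div, inv_pow, pow_succ]
      field_simp
      ring
    simp_rw [e]
    refine (summable_geometric_two.mul_left _).add (Summable.of_nonneg_of_le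
      (fun k => by positivity) (fun k => ?_) hdioph.abs)
    rw [abs_div, abs_of_pos (by positivity : (0 : ℝ) < 2 ^ (k + 1))]
    exact div_le_div_of_nonneg_right (max_le (abs_nonneg _) (le_abs_self _)) (by positivity)
  · exact fun k j Q hQ hk => (hε1 k).trans (hωle hQ.1 hQ.2 j hk)
  · rintro k j Q ⟨hQS, hQ2⟩ K ⟨hKS, hK2⟩ hQε hKε hlt
    by_contra! hgap
    -- `P = K - Q + e_i` with `i` in the support of `Q` divides `K`
    have hQ0 : Q ≠ 0 := by rintro rfl; simp at hQ2
    obtain ⟨i, hi⟩ := Finsupp.ne_iff.1 hQ0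
    have hiQ : Finsupp.single i 1 ≤ Q := by
      rw [Finsupp.single_le_iff]; exact Nat.one_le_iff_ne_zero.2 hi
    have hsub : K - Q + Q = K := tsub_add_cancel_of_le hlt.le
    have hne : K - Q ≠ 0 := fun h0 => hlt.ne (by rw [← hsub, h0, zero_add])
    have hPK : K - Q + Finsupp.single i 1 ≤ K := by
      conv_rhs => rw [← hsub]
      exact add_le_add_right hiQ _
    have hPS : K - Q + Finsupp.single i 1 ∉ multiples R := fun h =>
      hKS ((multiples R).upper hPK h)
    have hd := congrArg Finsupp.degree hsub
    have hPd : (K - Q + Finsupp.single i 1).degree = (K - Q).degree + 1 := by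
      rw [map_add, Finsupp.degree_single]
    have hne' : (K - Q).degree ≠ 0 := by simpa [Finsupp.degree_eq_zero_iff] using hne
    rw [map_add] at hd
    have hPle := hωle hPS (by omega) i (k := k + 1) (by omega)
    obtain ⟨q, hq⟩ := exists_smallDivisor_eq (hpos hPS (by omega) i)
    have e1 := (norm_le_smallDivisor μ Q j q).trans_lt hQε
    have e2 := (norm_le_smallDivisor μ K j q).trans_lt hKε
    have e3 : monomialFun K (μ q) = monomialFun (K - Q) (μ q) * monomialFun Q (μ q) := by
      rw [← monomialFun_add, hsub]
    set x := monomialFun (K - Q) (μ q)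
    set y := monomialFun Q (μ q)
    set w := ω (k + 1)
    have hw0 : 0 < w := hω0 _
    have hw1 : w ≤ 1 := hω1 _
    have e4 : a / 2 ≤ ‖y‖ := by
      have h6 : ‖μ q j‖ ≤ ‖y‖ + ‖y - μ q j‖ := by
        have := norm_sub_le y (y - μ q j)
        rwa [sub_sub_cancel] at this
      have h7 := ha q j
      have h8 : θ * w ≤ θ := mul_le_of_le_one_right hθ0.le hw1
      linarith
    have e5 : ‖x - 1‖ * ‖y‖ < 2 * (θ * w) := by
      have h6 : (x - 1) * y = (monomialFun K (μ q) - μ q j) - (y - μ q j) := by rw [e3]; ring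
      rw [← norm_mul, h6]
      linarith [norm_sub_le (monomialFun K (μ q) - μ q j) (y - μ q j)]
    have e6 : ‖x - 1‖ * (a / 2) < 2 * (θ * w) :=
      (mul_le_mul_of_nonneg_left e4 (norm_nonneg _)).trans_lt e5
    have e7 : w ≤ ‖x - 1‖ * b := by
      refine hPle.trans (hq.trans ?_)
      rw [monomialFun_add, monomialFun_single, ← sub_one_mul, norm_mul]
      exact mul_le_mul_of_nonneg_left (hb q i) (norm_nonneg _)
    have e8 : w * a < 4 * (b * θ) * w := by
      calc w * a ≤ ‖x - 1‖ * b * a := mul_le_mul_of_nonneg_right e7 ha0.le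
        _ = ‖x - 1‖ * (a / 2) * (2 * b) := by ring
        _ < 2 * (θ * w) * (2 * b) := mul_lt_mul_of_pos_right e6 (by positivity)
        _ = _ := by ring
    have e9 : 4 * (b * θ) * w = a / 2 * w := by rw [← hθb]; ring
    have e10 : 0 < a * w := mul_pos ha0 hw0
    linarith

end Diophantine

/-! ### Antiholomorphic changes of variables -/

theorem isBigO_antilinear (B : Matrix (Fin n) (Fin n) ℂ) (a : Fin n) :
    (fun z : Fin n → ℂ => (B.mulVec (star z)) a) =O[𝓝 0] fun z => ‖z‖ ^ 1 := by
  simp only [Matrix.mulVec, dotProduct]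
  refine IsBigO.fun_sum fun b _ => IsBigO.const_mul_left ?_ _
  exact (isBigO_coord b).norm_left.congr_left (fun z => (norm_star (z b)).symm) |>.of_norm_left

theorem isBigO_conj_comp {f : (Fin n → ℂ) → ℂ} {d : ℕ} (hf : f =O[𝓝 0] fun z => ‖z‖ ^ d)
    (B : Matrix (Fin n) (Fin n) ℂ) :
    (fun z => (starRingEnd ℂ) (f (B.mulVec (star z)))) =O[𝓝 0] fun z => ‖z‖ ^ d :=
  (isBigO_comp hf (isBigO_antilinear B)).norm_left.congr_left
    (fun _ => (RCLike.norm_conj _).symm) |>.of_norm_left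

/-- The polynomial whose value at `z` is the complex conjugate of `T(B z̄)`. -/
def conjSubst (B : Matrix (Fin n) (Fin n) ℂ) (T : MvPolynomial (Fin n) ℂ) :
    MvPolynomial (Fin n) ℂ :=
  bind₁ (fun a => ∑ b, C ((starRingEnd ℂ) (B a b)) * X b) (map (starRingEnd ℂ) T)

theorem eval_conjSubst (B : Matrix (Fin n) (Fin n) ℂ) (T : MvPolynomial (Fin n) ℂ)
    (z : Fin n → ℂ) : eval z (conjSubst B T) = (starRingEnd ℂ) (eval (B.mulVec (star z)) T) := by
  have h (w : Fin n → ℂ) : eval (fun a => (starRingEnd ℂ) (w a)) (map (starRingEnd ℂ) T) =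
      (starRingEnd ℂ) (eval w T) := by
    rw [eval_map, eval, coe_eval₂Hom, eval₂_comp_left]
    rfl
  rw [← h, conjSubst, eval_bind₁]
  congr 2
  funext a
  simp [Matrix.mulVec, dotProduct]

theorem HasTaylor.conj_comp {f : (Fin n → ℂ) → ℂ} (hf : HasTaylor f)
    (B : Matrix (Fin n) (Fin n) ℂ) :
    HasTaylor fun z => (starRingEnd ℂ) (f (B.mulVec (star z))) := fun d => by
  obtain ⟨T, hT⟩ := hf d
  refine ⟨conjSubst B T, (isBigO_conj_comp hT B).congr_left fun z => ?_⟩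
  rw [eval_conjSubst, map_sub]

theorem IsJet.conj_comp {Ψ : (Fin n → ℂ) → Fin n → ℂ} (hΨ : IsJet Ψ)
    (B : Matrix (Fin n) (Fin n) ℂ) : IsJet fun z => star (Ψ (B.mulVec (star z))) :=
  ⟨fun a => (hΨ.hasTaylor a).conj_comp B, fun a => isBigO_conj_comp (hΨ.isBigO a) B⟩

theorem eval_eq_zero_of_mem_monoIdeal {p : ℕ} {R : Fin p → (Fin n →₀ ℕ)}
    {T : MvPolynomial (Fin n) ℂ} (hT : T ∈ monoIdeal (multiples R)) {z : Fin n → ℂ}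
    (hz : ∀ k, monomialFun (R k) z = 0) : eval z T = 0 := by
  rw [eval_eq']
  refine Finset.sum_eq_zero fun Q hQ => ?_
  by_cases hQS : Q ∈ multiples R
  · obtain ⟨k, hk⟩ := hQS
    have : monomialFun Q z = 0 := by
      rw [← add_tsub_cancel_of_le hk, monomialFun_add, hz k, zero_mul]
    exact mul_eq_zero_of_right _ this
  · rw [mem_monoIdeal.1 hT Q hQS, zero_mul]

theorem conjSubst_mem {p : ℕ} {R : Fin p → (Fin n →₀ ℕ)} {B : Matrix (Fin n) (Fin n) ℂ}
    (hB : ∀ k, conjSubst B (monomial (R k) 1) ∈ monoIdeal (multiples R))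
    {T : MvPolynomial (Fin n) ℂ} (hT : T ∈ monoIdeal (multiples R)) :
    conjSubst B T ∈ monoIdeal (multiples R) := by
  rw [T.as_sum, conjSubst, map_sum, map_sum]
  refine Ideal.sum_mem _ fun Q hQ => ?_
  obtain ⟨k, hk⟩ : Q ∈ multiples R := by
    by_contra h
    exact (mem_support_iff.1 hQ) (mem_monoIdeal.1 hT Q h)
  have e : monomial Q (coeff Q T) = monomial (R k) 1 * monomial (Q - R k) (coeff Q T) := by
    rw [monomial_mul, add_tsub_cancel_of_le hk, one_mul]
  rw [e, map_mul, map_mul]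
  exact Ideal.mul_mem_right _ _ (hB k)

theorem MemUpTo.conj_comp {p : ℕ} {R : Fin p → (Fin n →₀ ℕ)} {B : Matrix (Fin n) (Fin n) ℂ}
    (hB : ∀ k, conjSubst B (monomial (R k) 1) ∈ monoIdeal (multiples R))
    {f : (Fin n → ℂ) → ℂ} {d : ℕ} (hf : MemUpTo (multiples R) d f) :
    MemUpTo (multiples R) d fun z => (starRingEnd ℂ) (f (B.mulVec (star z))) := by
  obtain ⟨T, hT, hfT⟩ := hf
  refine ⟨conjSubst B T, conjSubst_mem hB hT, (isBigO_conj_comp hfT B).congr_left fun z => ?_⟩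
  rw [eval_conjSubst, map_sub]

/-- If `z ↦ B z̄` permutes the maps `D_q` by conjugation, then it preserves the ideal: `x^{R_k}` is
turned into an invariant polynomial without constant term. -/
theorem conjSubst_monomial_mem {p : ℕ} {ι : Type*} {μ : ι → Fin n → ℂ}
    {R : Fin p → (Fin n →₀ ℕ)} (hR : ∀ k, R k ≠ 0) (hinv : InvariantsGeneratedBy μ R)
    {B : Matrix (Fin n) (Fin n) ℂ}
    (hB : ∀ q, ∃ q', ∀ z, μ q' * B.mulVec z = B.mulVec (star (μ q) * z)) (k : Fin p) :
    conjSubst B (monomial (R k) 1) ∈ monoIdeal (multiples R) := by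
  set h := conjSubst B (monomial (R k) 1) with hh
  have heval (z) : eval z h = (starRingEnd ℂ) (monomialFun (R k) (B.mulVec (star z))) := by
    rw [hh, eval_conjSubst, eval_monomial_eq, one_mul]
  have hdil (q) : dilate (μ q) h = h := by
    obtain ⟨q', hq'⟩ := hB q
    refine MvPolynomial.funext fun z => ?_
    rw [eval_dilate, heval, heval, star_mul', ← hq', monomialFun_mul,
      monomialFun_eq_one_of_invariantsGeneratedBy hR hinv, one_mul]
  refine mem_monoIdeal.2 fun Q hQ => ?_
  by_contra hne
  rcases eq_or_ne Q 0 with rfl | hQ0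
  · obtain ⟨a, ha⟩ := Finsupp.ne_iff.1 (hR k)
    have h0 : eval (0 : Fin n → ℂ) h = 0 := by
      rw [heval, star_zero, Matrix.mulVec_zero, monomialFun,
        Finset.prod_eq_zero (Finset.mem_univ a) (by simpa using ha), map_zero]
    rw [MvPolynomial.eval_zero, constantCoeff_eq] at h0
    exact hne h0
  · refine hQ (mem_multiples_of_invariantsGeneratedBy hR hinv hQ0 fun q => ?_)
    have := congrArg (coeff Q) (hdil q)
    rw [coeff_dilate] at this
    exact (mul_eq_right₀ hne).1 this

/-! ### Vanishing on the zero locus -/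

/-- A holomorphic function that belongs to the monomial ideal to all orders vanishes on the zero locus,
on a ball that does not depend on the point: the locus is a cone, and the restriction of the function
to a line in it vanishes to infinite order at the origin. -/
theorem eventually_eq_zero_on_locus {p : ℕ} {R : Fin p → (Fin n →₀ ℕ)} {f : (Fin n → ℂ) → ℂ}
    (hf : AnalyticAt ℂ f 0) (hfR : ∀ d, MemUpTo (multiples R) d f) :
    ∀ᶠ z in 𝓝 (0 : Fin n → ℂ), (∀ k, monomialFun (R k) z = 0) → f z = 0 := by
  obtain ⟨ε, hε, hball⟩ := hf.exists_ball_analyticOnNhd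
  filter_upwards [Metric.ball_mem_nhds (0 : Fin n → ℂ) hε] with z hz hV
  have hVt (t : ℂ) (k) : monomialFun (R k) (t • z) = 0 := by
    have : t • z = (fun _ => t) * z := by funext; simp
    rw [this, monomialFun_mul, hV k, mul_zero]
  let U : Set ℂ := (fun t : ℂ => t • z) ⁻¹' Metric.ball 0 ε
  have hU : IsPreconnected U :=
    ((convex_ball (0 : Fin n → ℂ) ε).linear_preimage
      ((LinearMap.id : ℂ →ₗ[ℝ] ℂ).smulRight z)).isPreconnected
  have hlin : Continuous fun t : ℂ => t • z := by fun_prop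
  have hg : AnalyticOnNhd ℂ (fun t : ℂ => f (t • z)) U := fun t ht =>
    (hball _ ht).comp_of_eq (((ContinuousLinearMap.id ℂ ℂ).smulRight z).analyticAt t) rfl
  have h0U : (0 : ℂ) ∈ U := by simp [U, hε]
  have h1U : (1 : ℂ) ∈ U := by simpa [U] using hz
  have hO (d : ℕ) : (fun t : ℂ => f (t • z)) =O[𝓝 0] fun t => ‖t‖ ^ d := by
    obtain ⟨T, hT, hfT⟩ := hfR d
    have ht : Tendsto (fun t : ℂ => t • z) (𝓝 0) (𝓝 0) := by simpa using hlin.tendsto 0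
    refine ((hfT.comp_tendsto ht).congr_left fun t => ?_).trans
      (IsBigO.of_bound (‖z‖ ^ d) (Eventually.of_forall fun t => ?_))
    · simp [eval_eq_zero_of_mem_monoIdeal hT (hVt t)]
    · simp [norm_smul, mul_pow, mul_comm]
  -- the order of vanishing `N` at the origin cannot be finite
  have hzero : ∀ᶠ t in 𝓝 (0 : ℂ), f (t • z) = 0 := by
    by_contra hne
    obtain ⟨N, g, hga, hg0, hgN⟩ := (hg 0 h0U).exists_eventuallyEq_pow_smul_nonzero_iff.2 hne
    obtain ⟨K, hK⟩ := (hO (N + 1)).bound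
    have h1 : ∀ᶠ t in 𝓝[≠] (0 : ℂ), ‖g t‖ ≤ K * ‖t‖ := by
      filter_upwards [nhdsWithin_le_nhds hgN, nhdsWithin_le_nhds hK, self_mem_nhdsWithin] with
        t h2 h3 h4
      have ht : 0 < ‖t‖ := norm_pos_iff.2 h4
      rw [h2, sub_zero, norm_smul, norm_pow, norm_pow, norm_norm, pow_succ] at h3
      refine le_of_mul_le_mul_left ?_ (pow_pos ht N)
      linarith
    have h2 : Tendsto (fun t : ℂ => K * ‖t‖) (𝓝[≠] 0) (𝓝 0) := by
      have : Continuous fun t : ℂ => K * ‖t‖ := by fun_prop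
      simpa using (this.tendsto 0).mono_left (nhdsWithin_le_nhds (s := {0}ᶜ))
    have h3 : Tendsto (fun t => ‖g t‖) (𝓝[≠] 0) (𝓝 ‖g 0‖) :=
      (hga.continuousAt.norm.tendsto).mono_left nhdsWithin_le_nhds
    exact hg0 (norm_le_zero_iff.1 (le_of_tendsto_of_tendsto h3 h2 h1))
  simpa using hg.eqOn_zero_of_preconnected_of_eventuallyEq_zero hU h0U hzero h1U

/-! ### Holomorphic coordinates -/

/-- The inverse function theorem, with the domain shrunk so that both maps are holomorphic on it. -/
theorem exists_isHolCoord {Ψ : (Fin n → ℂ) → Fin n → ℂ} (hΨ : AnalyticAt ℂ Ψ 0)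
    (h0 : Ψ 0 = 0) (h1 : HasFDerivAt Ψ (ContinuousLinearMap.id ℂ (Fin n → ℂ)) 0) :
    ∃ Φ : OpenPartialHomeomorph (Fin n → ℂ) (Fin n → ℂ), IsHolCoord Φ ∧ ⇑Φ.symm = Ψ := by
  have hstrict : HasStrictFDerivAt Ψ
      ((ContinuousLinearEquiv.refl ℂ (Fin n → ℂ) : (Fin n → ℂ) →L[ℂ] Fin n → ℂ)) 0 := by
    have := hΨ.hasStrictFDerivAt
    rwa [h1.fderiv] at this
  let e := hstrict.toOpenPartialHomeomorph Ψ
  have he : ⇑e = Ψ := hstrict.toOpenPartialHomeomorph_coe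
  have h0e : (0 : Fin n → ℂ) ∈ e.source := hstrict.mem_toOpenPartialHomeomorph_source
  have he0 : e 0 = 0 := by rw [he, h0]
  have hsymm : AnalyticAt ℂ e.symm 0 := by
    have := e.analyticAt_symm' (i := ContinuousLinearEquiv.refl ℂ (Fin n → ℂ)) h0e
      (by rwa [he]) (by rw [he, h1.fderiv]; rfl)
    rwa [he0] at this
  let s : Set (Fin n → ℂ) := {x | AnalyticAt ℂ Ψ x} ∩ (e.source ∩ e ⁻¹' {y | AnalyticAt ℂ e.symm y})
  have hs : IsOpen s := (isOpen_analyticAt ℂ Ψ).inter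
    (e.isOpen_inter_preimage (isOpen_analyticAt ℂ e.symm))
  let e' := e.restrOpen s hs
  have he's : e'.source = e.source ∩ s := e.restrOpen_source s hs
  have he'c : ⇑e' = Ψ := he
  have he'symm : ⇑e'.symm = e.symm := rfl
  have h0s : (0 : Fin n → ℂ) ∈ e'.source := by
    rw [he's]
    refine ⟨h0e, hΨ, h0e, ?_⟩
    change AnalyticAt ℂ e.symm (e 0)
    rwa [he0]
  have h0t : (0 : Fin n → ℂ) ∈ e'.target := by
    have := e'.map_source h0s
    rwa [he'c, h0] at this
  have hsymm0 : e'.symm 0 = 0 := by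
    have := e'.left_inv h0s
    rwa [he'c, h0] at this
  refine ⟨e'.symm, ⟨h0t, hsymm0, fun y hy => ?_, fun x hx => ?_, ?_⟩, ?_⟩
  · have hx := e'.map_target hy
    have h2 := e'.right_inv hy
    rw [he's] at hx
    have h3 : AnalyticAt ℂ e.symm (e (e'.symm y)) := hx.2.2.2
    rw [he, ← he'c, h2] at h3
    exact h3
  · have hx' : x ∈ e'.source := hx
    rw [he's] at hx'
    have : AnalyticAt ℂ Ψ x := hx'.2.1
    rw [← he'c] at this
    exact this
  · have := e'.hasFDerivAt_symm (f' := ContinuousLinearEquiv.refl ℂ (Fin n → ℂ)) h0t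
      (by rw [hsymm0, he'c]; exact h1)
    exact this
  · rw [OpenPartialHomeomorph.symm_symm, he'c]

/-! ### Linear parts and expansions of maps -/

/-- `Ψ(z) = L z + O(‖z‖^2)`. -/
def HasLinearPart (Ψ : (Fin n → ℂ) → Fin n → ℂ) (L : Matrix (Fin n) (Fin n) ℂ) : Prop :=
  ∀ a, (fun z => Ψ z a - L.mulVec z a) =O[𝓝 0] fun z => ‖z‖ ^ 2

theorem HasLinearPart.unique {Ψ : (Fin n → ℂ) → Fin n → ℂ} {L L' : Matrix (Fin n) (Fin n) ℂ}
    (h : HasLinearPart Ψ L) (h' : HasLinearPart Ψ L') : L = L' := by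
  ext a b
  have h1 : (fun z => eval z (∑ b, C (L a b - L' a b) * X b)) =O[𝓝 0]
      fun z : Fin n → ℂ => ‖z‖ ^ 2 := by
    refine ((h' a).sub (h a)).congr_left fun z => ?_
    simp [Matrix.mulVec, dotProduct, sub_mul]
  have h2 := coeff_eq_zero_of_isBigO_eval h1 (Finsupp.single b 1) (by simp)
  simp only [coeff_sum, coeff_C_mul, coeff_X, Finsupp.single_left_inj one_ne_zero] at h2
  simpa [sub_eq_zero] using h2

theorem HasLinearPart.conj_comp {Ψ : (Fin n → ℂ) → Fin n → ℂ} {L : Matrix (Fin n) (Fin n) ℂ}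
    (h : HasLinearPart Ψ L) (B : Matrix (Fin n) (Fin n) ℂ) :
    HasLinearPart (fun z => star (Ψ (B.mulVec (star z))))
      (L.map (starRingEnd ℂ) * B.map (starRingEnd ℂ)) := by
  intro a
  refine (isBigO_conj_comp (h a) B).congr_left fun z => ?_
  rw [map_sub, Matrix.mulVec_mulVec, ← Matrix.map_mul]
  simp [Matrix.mulVec, dotProduct]

theorem HasLinearPart.comp {G Ψ : (Fin n → ℂ) → Fin n → ℂ} {B L : Matrix (Fin n) (Fin n) ℂ}
    {b : Fin n → ∀ k : ℕ, (Fin (k + 2) → Fin n) → ℂ} (hG : ∀ j, HasTail (fun z => G z j) (B j) (b j))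
    (hΨ : IsJet Ψ) (h : HasLinearPart Ψ L) : HasLinearPart (fun z => G (Ψ z)) (B * L) := by
  intro a
  have h1 := isBigO_comp (hG a).isBigO_sub_linear hΨ.isBigO
  have h2 : (fun z => ∑ b, B a b * (Ψ z b - L.mulVec z b)) =O[𝓝 0] fun z => ‖z‖ ^ 2 :=
    IsBigO.fun_sum fun b _ => (h b).const_mul_left _
  refine (h1.add h2).congr_left fun z => ?_
  rw [← Matrix.mulVec_mulVec]
  simp only [Matrix.mulVec, dotProduct, mul_sub, Finset.sum_sub_distrib]
  ring

theorem HasLinearPart.hasFDerivAt {Ψ : (Fin n → ℂ) → Fin n → ℂ} {L : Matrix (Fin n) (Fin n) ℂ}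
    (h : HasLinearPart Ψ L) : HasFDerivAt Ψ L.mulVecLin.toContinuousLinearMap 0 := by
  have h1 : (fun z => Ψ z - L.mulVecLin.toContinuousLinearMap z) =O[𝓝 0] fun z => ‖z‖ ^ 2 :=
    isBigO_pi.2 h
  have h2 : HasFDerivAt (fun z => Ψ z - L.mulVecLin.toContinuousLinearMap z)
      (0 : (Fin n → ℂ) →L[ℂ] Fin n → ℂ) 0 :=
    IsBigO.hasFDerivAt (n := 2) (by simpa using h1) one_lt_two
  simpa using h2.add (L.mulVecLin.toContinuousLinearMap.hasFDerivAt (x := 0))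

theorem exists_hasTail_pi {G : (Fin n → ℂ) → Fin n → ℂ} {L : Matrix (Fin n) (Fin n) ℂ}
    (hG : AnalyticAt ℂ G 0) (hG0 : G 0 = 0)
    (hL : HasFDerivAt G L.mulVecLin.toContinuousLinearMap 0) :
    ∃ (c : Fin n → ∀ k : ℕ, (Fin (k + 2) → Fin n) → ℂ) (M A : ℝ), 0 ≤ M ∧ 0 ≤ A ∧
      (∀ j k w, ‖c j k w‖ ≤ M * A ^ k) ∧ ∀ j, HasTail (fun z => G z j) (L j) (c j) := by
  have h (j : Fin n) := exists_hasTail (analyticAt_pi_iff.1 hG j) (congrFun hG0 j)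
    (hasFDerivAt_pi'.1 hL j)
  choose c M A hM hA hc hT using h
  refine ⟨c, ∑ j, M j, ∑ j, A j, Finset.sum_nonneg fun j _ => hM j,
    Finset.sum_nonneg fun j _ => hA j, fun j k w => (hc j k w).trans ?_, fun j => ?_⟩
  · have h1 : M j ≤ ∑ j, M j := Finset.single_le_sum (fun j _ => hM j) (Finset.mem_univ j)
    have h2 : A j ≤ ∑ j, A j := Finset.single_le_sum (fun j _ => hA j) (Finset.mem_univ j)
    exact mul_le_mul h1 (pow_le_pow_left₀ (hA j) h2 k) (pow_nonneg (hA j) k)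
      ((hM j).trans h1)
  · convert hT j using 1
    funext b
    simp [Matrix.col]

/-! ### Families of antiholomorphic involutions -/

section Involutions

variable {m : ℕ} {ρ : Fin m → (Fin n → ℂ) → Fin n → ℂ} {B : Fin m → Matrix (Fin n) (Fin n) ℂ}

theorem IsAntiholInvolution.isJet_star {ρ : (Fin n → ℂ) → Fin n → ℂ}
    {B : Matrix (Fin n) (Fin n) ℂ} (h : IsAntiholInvolution ρ B) :
    IsJet (fun z => star (ρ z)) ∧ HasLinearPart (fun z => star (ρ z)) (B.map (starRingEnd ℂ)) ∧
      AnalyticAt ℂ (fun z => star (ρ z)) 0 := by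
  obtain ⟨c, -, -, -, -, -, hc⟩ := exists_hasTail_pi h.antiholomorphic
    (by simpa using h.map_zero) h.linearPart
  have hjet : IsJet fun w => ρ (star w) := ⟨fun a => (hc a).hasTaylor, fun a => (hc a).isBigO⟩
  have hlin : HasLinearPart (fun w => ρ (star w)) B := fun a => (hc a).isBigO_sub_linear
  have h1 := hjet.conj_comp 1
  have h2 := hlin.conj_comp 1
  have h3 := fun a => analyticAt_conj_comp_star (analyticAt_pi_iff.1 h.antiholomorphic a)
  simp only [Matrix.one_mulVec, star_star] at h1 h2 h3
  refine ⟨h1, ?_, analyticAt_pi_iff.2 h3⟩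
  simpa using h2

theorem IsAntiholInvolution.tendsto {ρ : (Fin n → ℂ) → Fin n → ℂ}
    {B : Matrix (Fin n) (Fin n) ℂ} (h : IsAntiholInvolution ρ B) : Tendsto ρ (𝓝 0) (𝓝 0) := by
  have := (continuous_star.tendsto (0 : Fin n → ℂ)).comp h.isJet_star.1.tendsto
  simpa [Function.comp_def] using this

theorem hasLinearPart_linMatrix (hρ : ∀ i, IsAntiholInvolution (ρ i) (B i)) (q : Fin m × Fin m) :
    HasLinearPart (fun z => ρ q.1 (ρ q.2 z)) (linMatrix B q) ∧
      AnalyticAt ℂ (fun z => ρ q.1 (ρ q.2 z)) 0 := by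
  obtain ⟨c, -, -, -, -, -, hc⟩ := exists_hasTail_pi (hρ q.1).antiholomorphic
    (by simpa using (hρ q.1).map_zero) (hρ q.1).linearPart
  obtain ⟨h1, h2, h3⟩ := (hρ q.2).isJet_star
  constructor
  · simpa [linMatrix] using HasLinearPart.comp hc h1 h2
  · have := (hρ q.1).antiholomorphic.comp_of_eq h3 (by simp [(hρ q.2).map_zero])
    simpa [Function.comp_def] using this

theorem mul_conj_self (hρ : ∀ i, IsAntiholInvolution (ρ i) (B i)) (i : Fin m) :
    B i * (B i).map (starRingEnd ℂ) = 1 := by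
  refine (hasLinearPart_linMatrix hρ (i, i)).1.unique fun a => ?_
  refine (isBigO_zero (fun z : Fin n → ℂ => ‖z‖ ^ 2) _).congr' ?_ EventuallyEq.rfl
  filter_upwards [(hρ i).involutive] with z hz
  simp [hz]

theorem conj_mul_self (hρ : ∀ i, IsAntiholInvolution (ρ i) (B i)) (i : Fin m) :
    (B i).map (starRingEnd ℂ) * B i = 1 :=
  mul_eq_one_comm.1 (mul_conj_self hρ i)

theorem eigenvalue_ne_zero (hρ : ∀ i, IsAntiholInvolution (ρ i) (B i))
    {μ : Fin m × Fin m → Fin n → ℂ} (hdiag : ∀ q, linMatrix B q = Matrix.diagonal (μ q))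
    (q : Fin m × Fin m) (a : Fin n) : μ q a ≠ 0 := by
  have h : linMatrix B (q.1, q.2) * linMatrix B (q.2, q.1) = 1 := by
    simp only [linMatrix]
    rw [Matrix.mul_assoc, ← Matrix.mul_assoc _ (B q.2), conj_mul_self hρ, Matrix.one_mul,
      mul_conj_self hρ]
  rw [hdiag, hdiag, Matrix.diagonal_mul_diagonal] at h
  have := congrFun (congrFun h a) a
  rw [Matrix.diagonal_apply_eq, Matrix.one_apply_eq] at this
  exact left_ne_zero_of_mul_eq_one this

/-- The map `z ↦ B_i z̄` conjugates `D_{j,k}` to `D_{k,j}`, because `B_i` times its conjugate is the identity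
and the `D_q`, being diagonal, commute. -/
theorem mul_mulVec_swap (hρ : ∀ i, IsAntiholInvolution (ρ i) (B i))
    {μ : Fin m × Fin m → Fin n → ℂ} (hdiag : ∀ q, linMatrix B q = Matrix.diagonal (μ q))
    (i : Fin m) (q : Fin m × Fin m) (z : Fin n → ℂ) :
    μ q.swap * (B i).mulVec z = (B i).mulVec (star (μ q) * z) := by
  have hd (ν v : Fin n → ℂ) : ν * v = (Matrix.diagonal ν).mulVec v := by
    funext a; rw [Matrix.mulVec_diagonal, Pi.mul_apply]
  have hs : Matrix.diagonal (star (μ q)) = (B q.1).map (starRingEnd ℂ) * B q.2 := by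
    have h1 := congrArg (fun M => M.map (starRingEnd ℂ)) (hdiag q)
    simp only [linMatrix] at h1
    rw [Matrix.map_mul, Matrix.diagonal_map (map_zero _)] at h1
    have h2 : ((B q.2).map (starRingEnd ℂ)).map (starRingEnd ℂ) = B q.2 := by
      ext; simp
    rw [h2] at h1
    rw [h1]
    rfl
  have hcomm : linMatrix B (q.2, q.1) * linMatrix B (i, q.1) =
      linMatrix B (i, q.1) * linMatrix B (q.2, q.1) := by
    rw [hdiag, hdiag, Matrix.diagonal_mul_diagonal, Matrix.diagonal_mul_diagonal]
    congr 1
    funext a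
    exact mul_comm _ _
  simp only [linMatrix] at hcomm
  have hmat : linMatrix B q.swap * B i = B i * ((B q.1).map (starRingEnd ℂ) * B q.2) := by
    have := congrArg (fun M => M * B q.1) hcomm
    simp only [Matrix.mul_assoc, conj_mul_self hρ, Matrix.mul_one] at this
    simpa [linMatrix, Matrix.mul_assoc] using this
  rw [hd, hd, hs, Matrix.mulVec_mulVec, Matrix.mulVec_mulVec, ← hmat, hdiag]

/-- `F_{j,k} ∘ ρ_i = ρ_i ∘ F_{k,j}`: conjugation by an involution inverts the abelian group. -/
theorem eventually_comp_swap (hρ : ∀ i, IsAntiholInvolution (ρ i) (B i)) (hcomm : IsCommutative ρ)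
    (i : Fin m) (q : Fin m × Fin m) :
    ∀ᶠ z in 𝓝 (0 : Fin n → ℂ), ρ q.1 (ρ q.2 (ρ i z)) = ρ i (ρ q.2 (ρ q.1 z)) := by
  have h1 := (hρ q.1).tendsto.eventually (hcomm q.1 q.2 i q.1)
  have h2 := ((hρ q.2).tendsto.comp (hρ q.1).tendsto).eventually (hρ q.1).involutive
  filter_upwards [h1, (hρ q.1).involutive, h2] with z h3 h4 h5
  rw [h4] at h3
  rw [h3]
  exact congrArg (ρ i) h5

end Involutions

end TotallyReal

end

open TotallyReal MvPolynomial Asymptotics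

theorem mainTheorem8 {n m p : ℕ}
    (ρ : Fin m → (Fin n → ℂ) → (Fin n → ℂ))
    (B : Fin m → Matrix (Fin n) (Fin n) ℂ)
    (hρ : ∀ i, TotallyReal.IsAntiholInvolution (ρ i) (B i))
    (hcomm : TotallyReal.IsCommutative ρ)
    (μ : Fin m × Fin m → Fin n → ℂ)
    (hdiag : ∀ q, TotallyReal.linMatrix B q = Matrix.diagonal (μ q))
    (R : Fin p → (Fin n →₀ ℕ))
    (hR : ∀ k, R k ≠ 0)
    (hinv : TotallyReal.InvariantsGeneratedBy μ R)
    (hcent : TotallyReal.CentralizerGeneratedBy μ R)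
    (hdioph : TotallyReal.IsDiophantineOn μ (TotallyReal.monomialIdeal R)) :
    ∃ (Φ : OpenPartialHomeomorph (Fin n → ℂ) (Fin n → ℂ)) (V : Set (Fin n → ℂ)),
      TotallyReal.IsHolCoord Φ ∧
      TotallyReal.IsZeroLocus (TotallyReal.monomialIdeal R) V ∧
      V = {z | ∀ k, TotallyReal.monomialFun (R k) z = 0} ∧
      ∀ i, ∀ᶠ z in 𝓝 (0 : Fin n → ℂ), z ∈ V →
        Φ (ρ i (Φ.symm z)) = Matrix.mulVec (B i) (star z) ∧
        Φ (ρ i (Φ.symm z)) ∈ V := by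
  set S := multiples R
  let F (q : Fin m × Fin m) (z : Fin n → ℂ) : Fin n → ℂ := ρ q.1 (ρ q.2 z)
  have hFtail (q) := exists_hasTail_pi (hasLinearPart_linMatrix hρ q).2
    (by simp [(hρ q.1).map_zero, (hρ q.2).map_zero]) (hasLinearPart_linMatrix hρ q).1.hasFDerivAt
  choose c M A hM hA hc hF using hFtail
  have hF' (q j) : HasTail (fun z => F q z j) (Pi.single j (μ q j)) (c q j) := by
    convert hF q j using 1
    rw [hdiag]
    funext b
    rcases eq_or_ne b j with rfl | h
    · simp
    · simp [h, Matrix.diagonal_apply_ne' _ h]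
  have hc' (q j k w) : ‖c q j k w‖ ≤ (∑ q, M q) * (∑ q, A q) ^ k := by
    have h1 : M q ≤ ∑ q, M q := Finset.single_le_sum (fun q _ => hM q) (Finset.mem_univ q)
    have h2 : A q ≤ ∑ q, A q := Finset.single_le_sum (fun q _ => hA q) (Finset.mem_univ q)
    exact (hc q j k w).trans (mul_le_mul h1 (pow_le_pow_left₀ (hA q) h2 k) (pow_nonneg (hA q) k)
      ((hM q).trans h1))
  -- there is no resonance outside the ideal
  have hS : ∀ Q ∉ S, 2 ≤ Q.degree → ∀ j, ∃ q, monomialFun Q (μ q) ≠ μ q j :=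
    fun Q hQ hQ2 j => exists_ne_of_centralizerGeneratedBy hcent hQ hQ2 j
  obtain ⟨W, hW1, hWe, ⟨K, hK, hWK⟩, hWmul, hWδ⟩ :=
    exists_weight_of_isDiophantineOn (eigenvalue_ne_zero hρ hdiag) hcent hdioph
  obtain ⟨Ψ, hΨa, hΨj, hΨ1, hΨd⟩ := exists_analytic_conjugacy
    (Finset.sum_nonneg fun q _ => hM q) (Finset.sum_nonneg fun q _ => hA q) hc' hF'
    (fun q r => hcomm q.1 q.2 r.1 r.2) (δ := fun j Q => smallDivisor μ Q j)
    (fun Q hQ hQ2 j => by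
      obtain ⟨q, hq⟩ := hS Q hQ hQ2 j
      have hpos : 0 < smallDivisor μ Q j :=
        (norm_pos_iff.2 (sub_ne_zero.2 hq)).trans_le (norm_le_smallDivisor μ Q j q)
      exact ⟨hpos, exists_smallDivisor_eq hpos⟩)
    hW1 hWe hK hWK hWmul hWδ
  have hΨlin : HasLinearPart Ψ 1 := fun a => by simpa using hΨ1 a
  have hΨ0 : Ψ 0 = 0 := tendsto_nhds_unique hΨa.continuousAt.tendsto hΨj.tendsto
  obtain ⟨Φ, hΦ, hΦΨ⟩ := exists_isHolCoord hΨa hΨ0 (by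
    convert hΨlin.hasFDerivAt using 1
    ext; simp)
  refine ⟨Φ, _, hΦ, isZeroLocus_monomialIdeal R, rfl, fun i => ?_⟩
  -- the antiholomorphic change of variables `z ↦ B_i z̄` preserves the ideal
  have hBi (k) : conjSubst (B i) (monomial (R k) 1) ∈ monoIdeal S :=
    conjSubst_monomial_mem hR hinv (fun q => ⟨q.swap, mul_mulVec_swap hρ hdiag i q⟩) k
  have hanti : Tendsto (fun z : Fin n → ℂ => (B i).mulVec (star z)) (𝓝 0) (𝓝 0) := by
    have h : Continuous fun z : Fin n → ℂ => (B i).mulVec (star z) :=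
      Continuous.matrix_mulVec continuous_const continuous_star
    simpa using h.tendsto 0
  have hΨanti : Tendsto (fun z : Fin n → ℂ => Ψ ((B i).mulVec (star z))) (𝓝 0) (𝓝 0) :=
    hΨj.tendsto.comp hanti
  -- the second conjugacy `ρ_i ∘ Ψ ∘ (B_i z̄)`
  obtain ⟨b, -, -, -, -, -, hb⟩ := exists_hasTail_pi (hρ i).antiholomorphic
    (by simpa using (hρ i).map_zero) (hρ i).linearPart
  let Ψ' (z : Fin n → ℂ) : Fin n → ℂ := ρ i (Ψ ((B i).mulVec (star z)))
  have hv := hΨj.conj_comp (B i)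
  have hΨ'j : IsJet Ψ' := by simpa using IsJet.comp hb hv
  have hΨ'lin : HasLinearPart Ψ' 1 := by
    have := HasLinearPart.comp hb hv (hΨlin.conj_comp (B i))
    simpa [mul_conj_self hρ] using this
  have hΨ'd (d q j) : MemUpTo S d (defect (F q) (μ q) Ψ' j) := by
    have hu := (hΨj.dilation (μ q.swap)).conj_comp (B i)
    have hw : IsJet fun z j => defect (F q.swap) (μ q.swap) Ψ j z := isJet_defect hF' hΨj q.swap
    have hw' := hw.conj_comp (B i)
    have hwd (a) := (hΨd d q.swap a).conj_comp hBi
    have h1 := (hb j).memUpTo_sub hu.hasTaylor hw'.hasTaylor hu.isBigO hw'.isBigO hwd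
    have h2 : MemUpTo S d fun z => ∑ a, B i j a *
        (starRingEnd ℂ) (defect (F q.swap) (μ q.swap) Ψ a ((B i).mulVec (star z))) :=
      MemUpTo.sum _ fun a _ => (hwd a).const_mul _
    refine ((h1.mono (Nat.le_succ d)).add h2).congr ?_
    filter_upwards [hΨanti.eventually (eventually_comp_swap hρ hcomm i q)] with z hz
    set y := (B i).mulVec (star z) with hy
    have e1 : (star fun a => star (Ψ (μ q.swap * y)) a +
        star (fun j => defect (F q.swap) (μ q.swap) Ψ j y) a) = F q.swap (Ψ y) := by
      funext a
      simp [defect]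
    have e2 : (star fun a => star (Ψ (μ q.swap * y)) a) = Ψ (μ q.swap * y) := star_star _
    have e3 : Ψ' (μ q * z) = ρ i (Ψ (μ q.swap * y)) := by
      rw [hy, mul_mulVec_swap hρ hdiag, ← star_mul']
    change ρ i (star fun a => star (Ψ (μ q.swap * y)) a +
        star (fun j => defect (F q.swap) (μ q.swap) Ψ j y) a) j -
      ρ i (star fun a => star (Ψ (μ q.swap * y)) a) j - _ + _ = _
    rw [e1, e2, defect, e3]
    refine (sub_add_cancel _ _).trans ?_
    exact congrArg (fun x => x j - ρ i (Ψ (μ q.swap * y)) j) hz.symm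
  have hzero : ∀ j, ∀ᶠ z in 𝓝 (0 : Fin n → ℂ), (∀ k, monomialFun (R k) z = 0) →
      Ψ' z j - Ψ z j = 0 := fun j => by
    refine eventually_eq_zero_on_locus ?_ fun d => memUpTo_sub_of_defect hF' hS hΨj hΨ'j hΨd hΨ'd
      (fun a => ((hΨ'lin a).sub (hΨlin a)).congr_left fun z => by ring) d j
    have hL := (B i).mulVecLin.toContinuousLinearMap.analyticAt (0 : Fin n → ℂ)
    have hlin : AnalyticAt ℂ (fun y => Ψ ((B i).mulVec y)) 0 := hΨa.comp_of_eq hL (Matrix.mulVec_zero _)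
    have hstar : AnalyticAt ℂ (fun z => star (Ψ ((B i).mulVec (star z)))) 0 :=
      analyticAt_pi_iff.2 fun a => analyticAt_conj_comp_star (analyticAt_pi_iff.1 hlin a)
    have hΨ'a : AnalyticAt ℂ Ψ' 0 := by
      have := (hρ i).antiholomorphic.comp_of_eq hstar (by simp [hΨ0])
      simpa [Function.comp_def] using this
    exact (analyticAt_pi_iff.1 hΨ'a j).sub (analyticAt_pi_iff.1 hΨa j)
  have hsource : ∀ᶠ z in 𝓝 (0 : Fin n → ℂ), (B i).mulVec (star z) ∈ Φ.target := by
    refine hanti.eventually (Φ.open_target.mem_nhds ?_)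
    simpa [hΦ.map_zero] using Φ.map_source hΦ.zero_mem
  filter_upwards [eventually_all.2 hzero, hΨanti.eventually (hρ i).involutive, hsource] with
    z h1 h2 h3 hV
  have h4 : Ψ' z = Ψ z := funext fun j => sub_eq_zero.1 (h1 j hV)
  have h5 : Φ (ρ i (Φ.symm z)) = (B i).mulVec (star z) := by
    rw [hΦΨ, ← h4, h2, ← hΦΨ, Φ.right_inv h3]
  refine ⟨h5, ?_⟩
  rw [h5]
  intro k
  have h6 := eval_eq_zero_of_mem_monoIdeal (hBi k) hV
  rw [eval_conjSubst, map_eq_zero, eval_monomial_eq, one_mul] at h6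
  exact h6
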